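/- Uplink network model. Fix $\alpha>2$, an integer $K\ge 0$, $\theta>0$, $\sigma>0$ and $0<\varepsilon<1$. For $\lambda_b>0$ the base stations (BSs) in $\mathbb{R}^2$ are $\Phi(\lambda_b)=\{Y_0\}\cup\Phi'$, where $Y_0=0$ is the typical BS and $\Phi'$ is a homogeneous Poisson point process of density $\lambda_b$. Conditionally on $\Phi(\lambda_b)$, each BS $Y$ serves one active mobile $U_Y$ that is uniformly distributed in the Voronoi cell of $Y$ with respect to $\Phi(\lambda_b)$, independently for different $Y$; write $U_0=U_{Y_0}$. Let $\mathcal{C}$ be the set of the $K$ BSs $Y\neq Y_0$ whose mobiles $U_Y$ are nearest to the origin. If all active mobiles transmit with power $p\ge 0$, the interference at $Y_0$ is $I=\sum_{Y\in\Phi(\lambda_b)\setminus(\{Y_0\}\cup\mathcal{C})}p|U_Y|^{-\alpha}$ and the outage probability is $$P_{\mathsf{out}}(\lambda_b,p)=\Pr\left(\frac{p|U_0|^{-\alpha}}{I+\sigma^2}<\theta\right).$$ Let $\mathcal{F}_c$ be the set of all $(\lambda_b,p)$ with $\lambda_b>0$, $p\ge 0$ and $P_{\mathsf{out}}(\lambda_b,p)\le\varepsilon$.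 For $m\ge 0$ put $$\varepsilon(m)=\Pr\left(\sum_{Y\in\Phi(1)}\left[|U_Y|^{-\alpha}\mathbf{1}\{Y\notin\{Y_0\}\cup\mathcal{C}\}-\theta^{-1}|U_0|^{-\alpha}\mathbf{1}\{Y=Y_0\}\right]+m>0\right).$$ Proposition. If $\varepsilon(0)<\varepsilon$, there is exactly one $\mu>0$ with $\varepsilon(\mu)=\varepsilon$. Whenever $\mu>0$ satisfies $\varepsilon(\mu)=\varepsilon$, $$\mathcal{F}_c=\left\{(\lambda_b,p)\in\mathbb{R}_+^2 : p\,\lambda_b^{\alpha/2}\ge\frac{\sigma^2}{\mu}\right\},$$ where $\mathbb{R}_+=[0,\infty)$. -/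

import Mathlib

open MeasureTheory ProbabilityTheory
open scoped ENNReal

noncomputable section

/-- The Euclidean plane, with its Euclidean norm and Lebesgue (area) measure. -/
abbrev Plane : Type := EuclideanSpace ℝ (Fin 2)

/-- The random set `Φ` of points of the plane is a homogeneous Poisson point process of density
`lam`: the number of points in a Borel set of finite area `v` is Poisson distributed with mean
`lam * v`, and the numbers of points in disjoint such sets are independent. -/
structure IsHomogeneousPPP {Ω : Type*} [MeasurableSpace Ω] (P : Measure Ω)
    (Φ : Ω → Set Plane) (lam : ℝ) : Prop where
  measurable_count : ∀ A : Set Plane, MeasurableSet A →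
    Measurable fun ω => (Φ ω ∩ A).encard
  law_count : ∀ A : Set Plane, MeasurableSet A → volume A ≠ ∞ →
    P.map (fun ω => (Φ ω ∩ A).encard) =
      (poissonMeasure (lam * volume.real A).toNNReal).map (fun k : ℕ => (k : ℕ∞))
  indep_count : ∀ (m : ℕ) (A : Fin m → Set Plane), (∀ i, MeasurableSet (A i)) →
    (∀ i, volume (A i) ≠ ∞) → Pairwise (fun i j => Disjoint (A i) (A j)) →
    iIndepFun (fun i ω => (Φ ω ∩ A i).encard) P

/-- The Voronoi cell of the nucleus `y` with respect to the set `S` of nuclei. -/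
def voronoiCell (S : Set Plane) (y : Plane) : Set Plane :=
  {x | ∀ z ∈ S, dist x y ≤ dist x z}

/-- Uplink Poisson-Voronoi cellular network of base-station density `lam`, seen from the typical
base station. The base stations are `Y 0, Y 1, Y 2, …`, where `Y 0 = 0` is the typical base
station and the other ones form a homogeneous Poisson point process of density `lam`, labelled in
the order of their distances from the origin. `U n` is the active mobile served by `Y n`:
conditionally on all base stations, the active mobiles are independent and `U n` is
uniformly distributed in the Voronoi cell of `Y n`. -/
structure IsUplinkNetwork {Ω : Type*} [MeasurableSpace Ω] (P : Measure Ω)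
    (Y U : ℕ → Ω → Plane) (lam : ℝ) : Prop where
  isProbabilityMeasure : IsProbabilityMeasure P
  measurable_station : ∀ n, Measurable (Y n)
  measurable_mobile : ∀ n, Measurable (U n)
  typical : ∀ ω, Y 0 ω = 0
  injective : ∀ᵐ ω ∂P, Function.Injective fun n => Y n ω
  ordered : ∀ᵐ ω ∂P, Monotone fun n => ‖Y n ω‖
  poisson : IsHomogeneousPPP P (fun ω => Set.range fun n => Y (n + 1) ω) lam
  uniform : ∀ (B : Set (ℕ → Plane)), MeasurableSet B →
    ∀ (s : Finset ℕ) (A : ℕ → Set Plane), (∀ i, MeasurableSet (A i)) →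
    P {ω | (fun n => Y n ω) ∈ B ∧ ∀ i ∈ s, U i ω ∈ A i} =
      ∫⁻ ω in {ω | (fun n => Y n ω) ∈ B},
        ∏ i ∈ s, (cond volume (voronoiCell (Set.range fun n => Y n ω) (Y i ω))) (A i) ∂P

/-- The labels of the base stations serving the `K` interfering mobiles nearest to the origin, for
the positions `u` of the active mobiles (`u 0` is the mobile of the typical base station and does
not interfere). -/
def canceled (K : ℕ) (u : ℕ → Plane) : Set ℕ :=
  {n | n ≠ 0 ∧ {m : ℕ | m ≠ 0 ∧ ‖u m‖ < ‖u n‖}.encard < K}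

open Classical in
/-- Interference power at the typical base station when all mobiles transmit with power `p`. -/
def interference (α : ℝ) (K : ℕ) (p : ℝ) (u : ℕ → Plane) : ℝ≥0∞ :=
  ∑' n : ℕ, if n ≠ 0 ∧ n ∉ canceled K u then ENNReal.ofReal p * ‖u n‖ₑ ^ (-α) else 0

/-- Signal-to-interference-and-noise ratio at the typical base station, with noise variance
`noise`. -/
def sinr (α : ℝ) (K : ℕ) (noise p : ℝ) (u : ℕ → Plane) : ℝ≥0∞ :=
  (ENNReal.ofReal p * ‖u 0‖ₑ ^ (-α)) / (interference α K p u + ENNReal.ofReal noise)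

/-- Outage probability of the typical base station: the probability that the
signal-to-interference-and-noise ratio is below `θ`. -/
def outageProb {Ω : Type*} [MeasurableSpace Ω] (P : Measure Ω) (U : ℕ → Ω → Plane)
    (α : ℝ) (K : ℕ) (θ noise p : ℝ) : ℝ :=
  P.real {ω | sinr α K noise p (fun n => U n ω) < ENNReal.ofReal θ}

/-- The feasibility region: all pairs `(lam, p)` of network parameters that satisfy the outage
constraint. A network has positive base-station density. -/
def feasibilityRegion (Pout : ℝ → ℝ → ℝ) (ε : ℝ) : Set (ℝ × ℝ) :=
  {x | 0 < x.1 ∧ 0 ≤ x.2 ∧ Pout x.1 x.2 ≤ ε}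

open Classical in
/-- The sum over all base stations of normalized interference minus normalized signal. -/
def normalizedSum (α : ℝ) (K : ℕ) (θ : ℝ) (u : ℕ → Plane) : ℝ :=
  ∑' n : ℕ, ((if n ≠ 0 ∧ n ∉ canceled K u then ‖u n‖ ^ (-α) else 0)
    - (if n = 0 then θ⁻¹ * ‖u 0‖ ^ (-α) else 0))

/-- The probability that the normalized sum plus `μ` is positive. -/
def exceedProb {Ω : Type*} [MeasurableSpace Ω] (P : Measure Ω) (U : ℕ → Ω → Plane)
    (α : ℝ) (K : ℕ) (θ μ : ℝ) : ℝ :=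
  P.real {ω | normalizedSum α K θ (fun n => U n ω) + μ > 0}

end

/-! Dilating the plane by `√lam` turns a network of density `lam` into one of density 1. Signal and
interference both change by the factor `lam ^ (-α / 2)`, which raising the power from `p` to `q = p
* lam ^ (α / 2)` undoes. So outage depends on `q` alone (`outageProb_eq_of_unit_density`). For `q >
0`, dividing the outage inequality by `θ * q` gives outage probability `ε(σ² / q)`
(`outageProb_eq_exceedProb`), and the region is `σ² / q ≤ μ` once `ε(·)` is strictly increasing on
the positive reals.

Networks of different densities live on unrelated probability spaces, so the dilated network can be
compared with the unit one only in law. The Poisson axioms fix the joint law of all counts, the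
counts fix the ordered stations (`map_stations_eq`), and these fix the law of the mobiles
(`map_mobiles_eq`).

The shape of `ε(·)` comes from the typical mobile, which is uniform in its cell given everything
else (`map_environment_mobile`). The normalized sum is then a constant minus a multiple of `‖U 0‖ ^
(-α)`. Its level sets are null, so `ε(·)` is continuous and tends to 1 (`continuous_exceedProb`).
Each interval of negative values is attained on an annulus around the origin, which lies in the cell
whenever the nearest other station is far enough; this has positive probability, so `ε(·)` increases
strictly (`exceedProb_lt`). All of this needs finite interference, which is where `α > 2` enters
(`ae_interference_ne_top`). -/

/-- Finite measures on a product that agree on boxes with finitely many constraints are equal. -/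
theorem measure_pi_ext {ι : Type*} {X : ι → Type*} [∀ i, MeasurableSpace (X i)]
    {μ ν : Measure (∀ i, X i)} [IsFiniteMeasure μ]
    (h : ∀ (s : Finset ι) (A : ∀ i, Set (X i)), (∀ i, MeasurableSet (A i)) →
      μ {f | ∀ i ∈ s, f i ∈ A i} = ν {f | ∀ i ∈ s, f i ∈ A i}) : μ = ν := by
  refine ext_of_generate_finite _ (generateFrom_squareCylinders (α := X)).symm
    (isPiSystem_squareCylinders (fun i => MeasurableSpace.isPiSystem_measurableSet)
      (fun i => MeasurableSet.univ)) ?_ ?_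
  · rintro _ ⟨s, A, hA, rfl⟩
    exact h s A fun i => hA i (Set.mem_univ i)
  · have := h ∅ (fun _ => Set.univ) fun _ => MeasurableSet.univ
    simpa using this

theorem poissonMeasure_zero_singleton (r : NNReal) :
    poissonMeasure r {0} = ENNReal.ofReal (Real.exp (-r)) := by
  simp [poissonMeasure_singleton]

theorem lintegral_cast_poissonMeasure (r : NNReal) :
    ∫⁻ k : ℕ, (k : ℝ≥0∞) ∂poissonMeasure r = r := by
  have hs : HasSum (fun n : ℕ => Real.exp (-r) * (r : ℝ) ^ n / n.factorial * n) r := by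
    rw [← hasSum_nat_add_iff' 1]
    have := (hasSum_one_poissonMeasure r).mul_left (r : ℝ)
    simp only [mul_one, Finset.range_one, Finset.sum_singleton, Nat.cast_zero, mul_zero,
      sub_zero] at this ⊢
    convert! this using 2 with n
    rw [Nat.factorial_succ]
    push_cast
    field_simp
    ring
  rw [poissonMeasure, lintegral_sum_measure]
  have : ∀ n : ℕ, ∫⁻ k : ℕ, (k : ℝ≥0∞) ∂(ENNReal.ofReal (Real.exp (-r) * (r : ℝ) ^ n /
      n.factorial) • Measure.dirac n) =
      ENNReal.ofReal (Real.exp (-r) * (r : ℝ) ^ n / n.factorial * n) := by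
    intro n
    rw [lintegral_smul_measure, lintegral_dirac, ENNReal.ofReal_mul (by positivity)]
    simp
  simp_rw [this]
  rw [← ENNReal.ofReal_tsum_of_nonneg (fun n => by positivity) hs.summable, hs.tsum_eq]
  simp

/-- From `exp (-r) ≥ 1 - r`, the tail `1 - exp (-r) * (1 + r)` is at most `1 - (1 - r) * (1 + r)`.
-/
theorem poissonMeasure_two_le (r : NNReal) :
    poissonMeasure r {n | 2 ≤ n} ≤ (r : ℝ≥0∞) ^ 2 := by
  have hc : {n : ℕ | 2 ≤ n} = ({0, 1} : Set ℕ)ᶜ := by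
    ext n
    simp only [Set.mem_ofPred_eq, Set.mem_compl_iff, Set.mem_insert_iff, Set.mem_singleton_iff]
    omega
  have hreal : (poissonMeasure r).real {n | 2 ≤ n} ≤ (r : ℝ) ^ 2 := by
    rw [hc, probReal_compl_eq_one_sub (by measurability), Set.insert_eq,
      measureReal_union (by simp) (by measurability), poissonMeasure_real_singleton,
      poissonMeasure_real_singleton]
    have h1 : 1 - (r : ℝ) ≤ Real.exp (-r) := by
      have := Real.add_one_le_exp (-(r : ℝ)); linarith
    have h2 : (0 : ℝ) ≤ r := r.2
    simp
    nlinarith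
  rw [← ENNReal.ofReal_toReal (measure_ne_top (poissonMeasure r) {n | 2 ≤ n})]
  refine (ENNReal.ofReal_le_ofReal hreal).trans_eq ?_
  rw [ENNReal.ofReal_pow (by positivity), ENNReal.ofReal_coe_nnreal]

/-! ### Joint law of the counts of a Poisson process -/

namespace IsHomogeneousPPP

universe u

variable {Ω : Type u} [MeasurableSpace Ω] {P : Measure Ω} {Φ : Ω → Set Plane} {lam : ℝ}

theorem measure_count_mem (h : IsHomogeneousPPP P Φ lam) {A : Set Plane} (hA : MeasurableSet A)
    (hv : volume A ≠ ∞) (D : Set ℕ∞) :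
    P {ω | (Φ ω ∩ A).encard ∈ D} =
      poissonMeasure (lam * volume.real A).toNNReal {k | (k : ℕ∞) ∈ D} := by
  have hD : MeasurableSet D := DiscreteMeasurableSpace.forall_measurableSet D
  have := congrArg (fun ν : Measure ℕ∞ => ν D) (h.law_count A hA hv)
  rwa [Measure.map_apply (h.measurable_count A hA) hD, Measure.map_apply (by fun_prop) hD] at this

theorem measure_count_eq_zero (h : IsHomogeneousPPP P Φ lam) {A : Set Plane}
    (hA : MeasurableSet A) (hv : volume A ≠ ∞) :
    P {ω | (Φ ω ∩ A).encard = 0} = ENNReal.ofReal (Real.exp (-(lam * volume.real A).toNNReal)) := by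
  have := h.measure_count_mem hA hv {0}
  rw [← poissonMeasure_zero_singleton]
  simpa using this

theorem measure_two_le_count (h : IsHomogeneousPPP P Φ lam) {A : Set Plane}
    (hA : MeasurableSet A) (hv : volume A ≠ ∞) :
    P {ω | 2 ≤ (Φ ω ∩ A).encard} ≤ ENNReal.ofReal (lam * volume.real A) ^ 2 := by
  have := h.measure_count_mem hA hv {n | 2 ≤ n}
  simp only [Set.mem_ofPred_eq] at this
  rw [this]
  refine le_trans (le_of_eq ?_) (poissonMeasure_two_le _)
  congr 1
  ext k
  simp only [Set.mem_ofPred_eq]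
  norm_cast

theorem lintegral_count (h : IsHomogeneousPPP P Φ lam) {A : Set Plane}
    (hA : MeasurableSet A) (hv : volume A ≠ ∞) :
    ∫⁻ ω, ((Φ ω ∩ A).encard : ℝ≥0∞) ∂P = ENNReal.ofReal (lam * volume.real A) := by
  have hm : Measurable fun n : ℕ∞ => (n : ℝ≥0∞) := measurable_from_top
  rw [← lintegral_map (f := fun n : ℕ∞ => (n : ℝ≥0∞)) hm (h.measurable_count A hA),
    h.law_count A hA hv, lintegral_map hm (by fun_prop)]
  simp only [ENat.toENNReal_coe]
  exact lintegral_cast_poissonMeasure _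

/-- The Borel sets of finite area. -/
abbrev FiniteAreaSet : Type := {A : Set Plane // MeasurableSet A ∧ volume A ≠ ∞}

/-- The numbers of points in all Borel sets of finite area. -/
noncomputable def counts (Φ : Ω → Set Plane) (ω : Ω) (A : FiniteAreaSet) : ℕ∞ :=
  (Φ ω ∩ A.1).encard

theorem measurable_counts (h : IsHomogeneousPPP P Φ lam) : Measurable (counts Φ) :=
  measurable_pi_lambda _ fun A => h.measurable_count A.1 A.2.1

/-- The part of `⋃ i, A i` that belongs to exactly the sets `A i` with `i ∈ T`. -/
def atom {ι : Type*} (A : ι → Set Plane) (T : Set ι) : Set Plane :=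
  (⋃ i, A i) ∩ {x | ∀ i, x ∈ A i ↔ i ∈ T}

theorem disjoint_atom {ι : Type*} (A : ι → Set Plane) :
    Pairwise fun T T' => Disjoint (atom A T) (atom A T') := by
  intro T T' hT
  rw [Set.disjoint_left]
  rintro x ⟨-, hx⟩ ⟨-, hx'⟩
  exact hT (Set.ext fun i => (hx i).symm.trans (hx' i))

theorem measurableSet_atom {ι : Type*} [Finite ι] {A : ι → Set Plane}
    (hA : ∀ i, MeasurableSet (A i)) (T : Set ι) : MeasurableSet (atom A T) := by
  refine (MeasurableSet.iUnion hA).inter ?_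
  simp only [Set.ofPred_forall]
  refine MeasurableSet.iInter fun i => ?_
  by_cases hi : i ∈ T
  · simpa [hi] using hA i
  · have : {x | x ∈ A i ↔ i ∈ T} = (A i)ᶜ := by ext x; simp [hi]
    rw [this]
    exact (hA i).compl

/-- Intersecting with the union matters for `T = ∅`: that atom is empty instead of being the
complement of the union, which has infinite area. -/
theorem volume_atom_ne_top {ι : Type*} [Finite ι] {A : ι → Set Plane}
    (hA : ∀ i, volume (A i) ≠ ∞) (T : Set ι) : volume (atom A T) ≠ ∞ := by
  cases nonempty_fintype ι
  refine ((measure_mono Set.inter_subset_left).trans_lt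
    ((measure_iUnion_fintype_le volume A).trans_lt ?_)).ne
  exact ENNReal.sum_lt_top.2 fun i _ => (hA i).lt_top

open Classical in
theorem encard_inter_eq_sum_atom {ι : Type*} [Fintype ι] (A : ι → Set Plane) (S : Set Plane)
    (i : ι) :
    (S ∩ A i).encard = ∑ T : Set ι, if i ∈ T then (S ∩ atom A T).encard else 0 := by
  have : S ∩ A i = ⋃ T : Set ι, if i ∈ T then S ∩ atom A T else ∅ := by
    ext x
    simp only [Set.mem_iUnion]
    constructor
    · rintro ⟨hS, hx⟩
      refine ⟨{j | x ∈ A j}, ?_⟩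
      rw [if_pos (show i ∈ {j | x ∈ A j} from hx)]
      exact ⟨hS, Set.mem_iUnion.2 ⟨i, hx⟩, fun j => Iff.rfl⟩
    · rintro ⟨T, hT⟩
      split_ifs at hT with h
      · exact ⟨hT.1, (hT.2.2 i).2 h⟩
      · exact hT.elim
  rw [this, Set.encard_iUnion_of_finite, finsum_eq_sum_of_fintype]
  · refine Finset.sum_congr rfl fun T _ => ?_
    split_ifs <;> simp
  · intro T T' hT
    simp only [Function.onFun]
    split_ifs
    · exact ((disjoint_atom A hT).mono Set.inter_subset_right Set.inter_subset_right)
    all_goals simp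

/-- Independence is assumed only for disjoint sets; the atoms are disjoint, and overlapping sets are
recovered by summing over atoms. -/
theorem map_atoms_eq (h : IsHomogeneousPPP P Φ lam) [IsProbabilityMeasure P]
    {ι : Type*} [Fintype ι] {A : ι → Set Plane}
    (hA : ∀ i, MeasurableSet (A i)) (hv : ∀ i, volume (A i) ≠ ∞) :
    P.map (fun ω (T : Set ι) => (Φ ω ∩ atom A T).encard) =
      Measure.pi fun T : Set ι =>
        (poissonMeasure (lam * volume.real (atom A T)).toNNReal).map (fun k : ℕ => (k : ℕ∞)) := by
  have hi : iIndepFun (fun (T : Set ι) ω => (Φ ω ∩ atom A T).encard) P := by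
    let e := Fintype.equivFin (Set ι)
    have := h.indep_count (Fintype.card (Set ι)) (fun j => atom A (e.symm j))
      (fun j => measurableSet_atom hA _) (fun j => volume_atom_ne_top hv _)
      (fun j j' hj => disjoint_atom A (e.symm.injective.ne hj))
    have h2 := this.precomp e.injective
    simpa using h2
  rw [(iIndepFun_iff_map_fun_eq_pi_map fun T =>
    (h.measurable_count _ (measurableSet_atom hA T)).aemeasurable).1 hi]
  congr 1
  funext T
  exact h.law_count _ (measurableSet_atom hA T) (volume_atom_ne_top hv T)

/-- The joint law of all counts of a homogeneous Poisson point process depends on its density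
only. -/
theorem map_counts_eq {Ω' : Type u} [MeasurableSpace Ω'] {P' : Measure Ω'} {Φ' : Ω' → Set Plane}
    [IsProbabilityMeasure P] [IsProbabilityMeasure P']
    (h : IsHomogeneousPPP P Φ lam) (h' : IsHomogeneousPPP P' Φ' lam) :
    P.map (counts Φ) = P'.map (counts Φ') := by
  classical
  have := Measure.isProbabilityMeasure_map (μ := P) h.measurable_counts.aemeasurable
  refine measure_pi_ext fun s D hD => ?_
  let A : s → Set Plane := fun i => i.1.1
  -- `G` rebuilds the counts of the overlapping sets from the counts of their atoms.
  let G : (Set s → ℕ∞) → s → ℕ∞ := fun f i => ∑ T : Set s, if i ∈ T then f T else 0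
  let E : Set (Set s → ℕ∞) := {f | ∀ i : s, G f i ∈ D i}
  have hE : MeasurableSet E := by
    exact DiscreteMeasurableSpace.forall_measurableSet E
  have key : ∀ {Ω₁ : Type u} [MeasurableSpace Ω₁] {P₁ : Measure Ω₁} {Φ₁ : Ω₁ → Set Plane}
      (_ : IsProbabilityMeasure P₁) (_ : IsHomogeneousPPP P₁ Φ₁ lam),
      (P₁.map (counts Φ₁)) {f | ∀ i ∈ s, f i ∈ D i} = (Measure.pi fun T : Set s =>
        (poissonMeasure (lam * volume.real (atom A T)).toNNReal).map (fun k : ℕ => (k : ℕ∞))) E := by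
    intro Ω₁ _ P₁ Φ₁ hP₁ h₁
    rw [← h₁.map_atoms_eq (A := A) (fun i => i.1.2.1) (fun i => i.1.2.2), Measure.map_apply _ hE,
      Measure.map_apply h₁.measurable_counts]
    · congr 1
      ext ω
      have hG : ∀ i : s, G (fun T => (Φ₁ ω ∩ atom A T).encard) i = counts Φ₁ ω i := fun i =>
        (encard_inter_eq_sum_atom A (Φ₁ ω) i).symm
      simp only [Set.preimage_ofPred_eq, Set.mem_ofPred_eq, E, hG]
      exact ⟨fun h i => h i.1 i.2, fun h i hi => h ⟨i, hi⟩⟩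
    · exact MeasurableSet.pi s.countable_toSet (t := D) fun i _ => hD i
    · exact measurable_pi_lambda _ fun T =>
        h₁.measurable_count _ (measurableSet_atom (fun i => i.1.2.1) T)
  rw [key inferInstance h, key inferInstance h']

end IsHomogeneousPPP

/-! ### Distinct distances and summable dyadic counts -/

/-- The annulus of all points `x` of the plane with `⌊k * ‖x‖ ^ 2⌋ = j`. -/
def annulus (k j : ℕ) : Set Plane := {x | j ≤ k * ‖x‖ ^ 2 ∧ k * ‖x‖ ^ 2 < j + 1}

theorem measurableSet_annulus (k j : ℕ) : MeasurableSet (annulus k j) := by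
  have h1 : MeasurableSet {x : Plane | (j : ℝ) ≤ k * ‖x‖ ^ 2} :=
    measurableSet_le (by fun_prop) (by fun_prop)
  have h2 : MeasurableSet {x : Plane | k * ‖x‖ ^ 2 < (j : ℝ) + 1} :=
    measurableSet_lt (by fun_prop) (by fun_prop)
  exact h1.inter h2

theorem mem_ball_sqrt_iff {x : Plane} {a : ℝ} : x ∈ Metric.ball 0 √a ↔ ‖x‖ ^ 2 < a := by
  rw [mem_ball_zero_iff, Real.lt_sqrt (norm_nonneg x)]

theorem volume_ball_sqrt {a : ℝ} (ha : 0 ≤ a) :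
    volume (Metric.ball (0 : Plane) √a) = ENNReal.ofReal (a * Real.pi) := by
  rw [EuclideanSpace.volume_ball_fin_two, ← ENNReal.ofReal_pow (Real.sqrt_nonneg a),
    Real.sq_sqrt ha, ENNReal.ofReal_mul ha]

theorem volume_annulus {k : ℕ} (hk : 0 < k) (j : ℕ) :
    volume (annulus k j) = ENNReal.ofReal (Real.pi / k) := by
  have hk' : (0 : ℝ) < k := by exact_mod_cast hk
  have : annulus k j = Metric.ball 0 √((j + 1) / k) \ Metric.ball 0 √(j / k) := by
    ext x
    rw [Set.mem_sdiff, mem_ball_sqrt_iff, mem_ball_sqrt_iff, lt_div_iff₀ hk', lt_div_iff₀ hk',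
      not_lt, mul_comm, and_comm]
    rfl
  rw [this, measure_sdiff (Metric.ball_subset_ball (by gcongr; linarith))
    measurableSet_ball.nullMeasurableSet (measure_ball_lt_top).ne, volume_ball_sqrt (by positivity),
    volume_ball_sqrt (by positivity), ← ENNReal.ofReal_sub _ (by positivity)]
  congr 1
  ring

namespace IsHomogeneousPPP

variable {Ω : Type*} [MeasurableSpace Ω] {P : Measure Ω} {Φ : Ω → Set Plane} {lam : ℝ}

/-- A tie puts two points into one of `k * M` annuli of equal area `π / k`. Each has this with
probability at most `(lam * π / k) ^ 2`, so the union bound vanishes as `k` grows. -/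
theorem measure_tie_le (h : IsHomogeneousPPP P Φ lam) (hlam : 0 < lam) (M k : ℕ) (hk : 0 < k) :
    P {ω | ∃ x ∈ Φ ω, ∃ y ∈ Φ ω, x ≠ y ∧ ‖x‖ = ‖y‖ ∧ ‖x‖ ^ 2 < M} ≤
      ENNReal.ofReal (M * (lam * Real.pi) ^ 2 / k) := by
  have hk' : (0 : ℝ) < k := by exact_mod_cast hk
  have hsub : {ω | ∃ x ∈ Φ ω, ∃ y ∈ Φ ω, x ≠ y ∧ ‖x‖ = ‖y‖ ∧ ‖x‖ ^ 2 < M} ⊆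
      ⋃ j ∈ Finset.range (k * M), {ω | 2 ≤ (Φ ω ∩ annulus k j).encard} := by
    rintro ω ⟨x, hx, y, hy, hxy, hn, hM⟩
    have hpos : 0 ≤ k * ‖x‖ ^ 2 := by positivity
    have hxa : x ∈ annulus k ⌊k * ‖x‖ ^ 2⌋₊ := ⟨Nat.floor_le hpos, Nat.lt_floor_add_one _⟩
    have hya : y ∈ annulus k ⌊k * ‖x‖ ^ 2⌋₊ := by
      simpa only [annulus, Set.mem_ofPred_eq, ← hn] using hxa
    simp only [Set.mem_iUnion, Finset.mem_range, Set.mem_ofPred_eq, exists_prop]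
    refine ⟨⌊k * ‖x‖ ^ 2⌋₊, ?_, ?_⟩
    · rw [Nat.floor_lt hpos]
      push_cast
      exact mul_lt_mul_of_pos_left hM hk'
    · rw [← Set.encard_pair hxy]
      refine Set.encard_le_encard ?_
      rintro z (rfl | rfl)
      exacts [⟨hx, hxa⟩, ⟨hy, hya⟩]
  refine (measure_mono hsub).trans ((measure_biUnion_finset_le _ _).trans ?_)
  have hb : ∀ j ∈ Finset.range (k * M), P {ω | 2 ≤ (Φ ω ∩ annulus k j).encard} ≤
      ENNReal.ofReal ((lam * (Real.pi / k)) ^ 2) := by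
    intro j _
    refine (h.measure_two_le_count (measurableSet_annulus k j) ?_).trans_eq ?_
    · rw [volume_annulus hk]; exact ENNReal.ofReal_ne_top
    · rw [measureReal_def, volume_annulus hk, ENNReal.toReal_ofReal (by positivity),
        ENNReal.ofReal_pow (by positivity)]
  refine (Finset.sum_le_sum hb).trans_eq ?_
  rw [Finset.sum_const, Finset.card_range, nsmul_eq_mul, ← ENNReal.ofReal_natCast,
    ← ENNReal.ofReal_mul (by positivity)]
  congr 1
  push_cast
  field_simp

/-- The points of a homogeneous Poisson point process have distinct distances from the origin. -/
theorem ae_norm_injOn (h : IsHomogeneousPPP P Φ lam) (hlam : 0 < lam) :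
    ∀ᵐ ω ∂P, Set.InjOn (fun x : Plane => ‖x‖) (Φ ω) := by
  have hM : ∀ M : ℕ,
      P {ω | ∃ x ∈ Φ ω, ∃ y ∈ Φ ω, x ≠ y ∧ ‖x‖ = ‖y‖ ∧ ‖x‖ ^ 2 < M} = 0 := by
    intro M
    have hlim : Filter.Tendsto
        (fun k : ℕ => ENNReal.ofReal (M * (lam * Real.pi) ^ 2 / k)) Filter.atTop (nhds 0) := by
      rw [← ENNReal.ofReal_zero]
      exact ENNReal.tendsto_ofReal (tendsto_const_div_atTop_nhds_zero_nat _)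
    refine le_antisymm (ge_of_tendsto hlim ?_) bot_le
    filter_upwards [Filter.eventually_gt_atTop 0] with k hk using h.measure_tie_le hlam M k hk
  have hall : ∀ᵐ ω ∂P, ∀ M : ℕ,
      ¬ ∃ x ∈ Φ ω, ∃ y ∈ Φ ω, x ≠ y ∧ ‖x‖ = ‖y‖ ∧ ‖x‖ ^ 2 < M := by
    rw [ae_all_iff]
    intro M
    rw [ae_iff]
    simpa only [not_not] using hM M
  filter_upwards [hall] with ω hω x hx y hy hxy
  by_contra hne
  obtain ⟨M, hM⟩ := exists_nat_gt (‖x‖ ^ 2)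
  exact hω M ⟨x, hx, y, hy, hne, hxy, hM⟩

/-- A geometrically weighted sum of the numbers of points in dyadic discs is finite. -/
theorem ae_tsum_ball_lt_top (h : IsHomogeneousPPP P Φ lam) (hlam : 0 < lam) {α : ℝ}
    (hα : 2 < α) :
    ∀ᵐ ω ∂P, ∑' k : ℕ, ENNReal.ofReal (((2 : ℝ) ^ (-α)) ^ k) *
      ((Φ ω ∩ Metric.ball 0 (2 ^ (k + 1))).encard : ℝ≥0∞) < ∞ := by
  have hme : Measurable fun n : ℕ∞ => (n : ℝ≥0∞) := measurable_from_top
  have hm : ∀ k : ℕ, Measurable fun ω => ENNReal.ofReal (((2 : ℝ) ^ (-α)) ^ k) *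
      ((Φ ω ∩ Metric.ball 0 (2 ^ (k + 1))).encard : ℝ≥0∞) := fun k =>
    (hme.comp (h.measurable_count _ measurableSet_ball)).const_mul _
  refine ae_lt_top (Measurable.tsum hm) ?_
  rw [lintegral_tsum fun k => (hm k).aemeasurable]
  -- The mean count in the disc of radius `2 ^ (k + 1)` grows like `4 ^ k`, so the expected sum is
  -- geometric with ratio `4 * 2 ^ (-α)`, below 1 exactly when `α > 2`.
  have hterm : ∀ k : ℕ, ∫⁻ ω, ENNReal.ofReal (((2 : ℝ) ^ (-α)) ^ k) *
      ((Φ ω ∩ Metric.ball 0 (2 ^ (k + 1))).encard : ℝ≥0∞) ∂P =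
      ENNReal.ofReal (4 * lam * Real.pi * (4 * (2 : ℝ) ^ (-α)) ^ k) := by
    intro k
    have hk : Measurable fun ω => ((Φ ω ∩ Metric.ball 0 (2 ^ (k + 1))).encard : ℝ≥0∞) :=
      hme.comp (h.measurable_count _ measurableSet_ball)
    rw [lintegral_const_mul _ hk,
      h.lintegral_count measurableSet_ball measure_ball_lt_top.ne, measureReal_def,
      EuclideanSpace.volume_ball_fin_two, ← ENNReal.ofReal_mul (by positivity),
      ← ENNReal.ofReal_pow (by positivity), ← ENNReal.ofReal_mul (by positivity),
      ENNReal.toReal_ofReal (by positivity)]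
    congr 1
    rw [mul_pow, show (4 : ℝ) = 2 ^ 2 by norm_num, ← pow_mul, ← pow_mul]
    ring
  simp_rw [hterm]
  have hr : 4 * (2 : ℝ) ^ (-α) < 1 := by
    have : (4 : ℝ) = 2 ^ (2 : ℝ) := by norm_num
    rw [this, ← Real.rpow_add two_pos]
    exact Real.rpow_lt_one_of_one_lt_of_neg one_lt_two (by linarith)
  have hs := (summable_geometric_of_lt_one (by positivity) hr).mul_left (4 * lam * Real.pi)
  rw [← ENNReal.ofReal_tsum_of_nonneg (fun k => by positivity) hs]
  exact ENNReal.ofReal_ne_top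

end IsHomogeneousPPP

/-! ### Law of the ordered base stations -/

namespace IsUplinkNetwork

universe u

variable {Ω : Type u} [MeasurableSpace Ω] {P : Measure Ω} {Y U : ℕ → Ω → Plane} {lam : ℝ}

theorem ae_strictMono (h : IsUplinkNetwork P Y U lam) (hlam : 0 < lam) :
    ∀ᵐ ω ∂P, StrictMono fun n => ‖Y n ω‖ := by
  filter_upwards [h.injective, h.ordered, h.poisson.ae_norm_injOn hlam] with ω hi ho hn
  refine ho.strictMono_of_injective ?_
  intro m n hmn
  have hz : ∀ n, ‖Y n ω‖ = 0 → n = 0 := fun n hn => hi (by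
    simp only [h.typical ω]
    exact norm_eq_zero.1 hn)
  have h0 : ‖Y 0 ω‖ = 0 := by rw [h.typical ω, norm_zero]
  simp only at hmn
  rcases m with _ | m
  · exact (hz n (hmn ▸ h0)).symm
  rcases n with _ | n
  · exact hz _ (hmn.trans h0)
  · exact hi (hn ⟨m, rfl⟩ ⟨n, rfl⟩ hmn)

theorem encard_range_inter {g : ℕ → Plane} (hg : Function.Injective g) (A : Set Plane) :
    (Set.range g ∩ A).encard = {n | g n ∈ A}.encard := by
  rw [← hg.encard_image, Set.inter_comm, ← Set.image_preimage_eq_inter_range]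
  rfl

/-- The sum of the path losses from all interfering base stations is finite. -/
theorem ae_tsum_station_lt_top (h : IsUplinkNetwork P Y U lam) (hlam : 0 < lam) {α : ℝ}
    (hα : 2 < α) : ∀ᵐ ω ∂P, ∑' n, ‖Y (n + 1) ω‖ₑ ^ (-α) < ∞ := by
  filter_upwards [h.ae_strictMono hlam, h.injective, h.poisson.ae_tsum_ball_lt_top hlam hα]
    with ω hs hi hG
  have hinj : Function.Injective fun n => Y (n + 1) ω := fun m n hmn => by
    simpa using hi hmn
  have hcount : ∀ k : ℕ, ((Set.range (fun n => Y (n + 1) ω) ∩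
      Metric.ball 0 (2 ^ (k + 1))).encard : ℝ≥0∞) =
      ∑' n, (Metric.ball 0 (2 ^ (k + 1))).indicator (1 : Plane → ℝ≥0∞) (Y (n + 1) ω) := by
    intro k
    rw [encard_range_inter hinj, ← ENNReal.tsum_set_one, tsum_subtype _ (fun _ => (1 : ℝ≥0∞))]
    rfl
  simp_rw [hcount] at hG
  have h1 : 0 < ‖Y 1 ω‖ := by
    have := hs (zero_lt_one (α := ℕ))
    simpa [h.typical ω] using this
  have hc : ‖Y 1 ω‖ₑ ^ (-α) < ∞ := by
    rw [← ofReal_norm, ENNReal.ofReal_rpow_of_pos h1]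
    exact ENNReal.ofReal_lt_top
  have h0 : ∑' n, (Metric.ball 0 (2 ^ (0 + 1))).indicator (1 : Plane → ℝ≥0∞) (Y (n + 1) ω) < ∞ := by
    have := (ENNReal.le_tsum 0).trans_lt hG
    simpa using this
  -- Stations closer than 1 are bounded by the path loss of the nearest one, and only finitely many
  -- lie in the disc of radius 2. Any other station has `2 ^ k ≤ ‖y‖ < 2 ^ (k + 1)` for some `k`,
  -- and the `k`-th term alone dominates it.
  have hpt : ∀ n, ‖Y (n + 1) ω‖ₑ ^ (-α) ≤
      ‖Y 1 ω‖ₑ ^ (-α) * (Metric.ball 0 (2 ^ (0 + 1))).indicator (1 : Plane → ℝ≥0∞) (Y (n + 1) ω) +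
      ∑' k : ℕ, ENNReal.ofReal (((2 : ℝ) ^ (-α)) ^ k) *
        (Metric.ball 0 (2 ^ (k + 1))).indicator (1 : Plane → ℝ≥0∞) (Y (n + 1) ω) := by
    intro n
    have hle : ‖Y 1 ω‖ ≤ ‖Y (n + 1) ω‖ := hs.monotone (by omega)
    have hpos : 0 < ‖Y (n + 1) ω‖ := h1.trans_le hle
    have hneg : -α ≤ 0 := by linarith
    have hrw : ∀ x : Plane, 0 < ‖x‖ → ‖x‖ₑ ^ (-α) = ENNReal.ofReal (‖x‖ ^ (-α)) := fun x hx => by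
      rw [← ofReal_norm, ENNReal.ofReal_rpow_of_pos hx]
    by_cases hb : ‖Y (n + 1) ω‖ < 1
    · refine le_add_right ?_
      rw [Set.indicator_of_mem (by rw [mem_ball_zero_iff]; norm_num; linarith), Pi.one_apply,
        mul_one, hrw _ hpos, hrw _ h1]
      exact ENNReal.ofReal_le_ofReal (Real.rpow_le_rpow_of_nonpos h1 hle hneg)
    · obtain ⟨k, hk1, hk2⟩ := exists_nat_pow_near (not_lt.1 hb) one_lt_two
      refine le_add_left (le_trans ?_ (ENNReal.le_tsum k))
      rw [Set.indicator_of_mem (by rwa [mem_ball_zero_iff]), Pi.one_apply,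
        mul_one, hrw _ hpos]
      refine ENNReal.ofReal_le_ofReal ?_
      rw [← Real.rpow_natCast, ← Real.rpow_mul two_pos.le, mul_comm, Real.rpow_mul two_pos.le,
        Real.rpow_natCast]
      exact Real.rpow_le_rpow_of_nonpos (by positivity) hk1 hneg
  refine (ENNReal.tsum_le_tsum hpt).trans_lt ?_
  rw [ENNReal.tsum_add, ENNReal.tsum_mul_left, ENNReal.tsum_comm]
  simp_rw [ENNReal.tsum_mul_left]
  exact ENNReal.add_lt_top.2 ⟨ENNReal.mul_lt_top hc h0, hG⟩

/-- The closed disc of radius `r` around the origin. -/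
def disc (r : ℚ) : IsHomogeneousPPP.FiniteAreaSet :=
  ⟨Metric.closedBall 0 r, measurableSet_closedBall, measure_closedBall_lt_top.ne⟩

/-- The part of `A` between two circles around the origin. -/
def ringPart (r s : ℚ) {A : Set Plane} (hA : MeasurableSet A) : IsHomogeneousPPP.FiniteAreaSet :=
  ⟨(Metric.closedBall 0 s \ Metric.closedBall 0 r) ∩ A,
    (measurableSet_closedBall.diff measurableSet_closedBall).inter hA,
    ((measure_mono (Set.inter_subset_left.trans Set.sdiff_subset)).trans_lt
      measure_closedBall_lt_top).ne⟩

theorem encard_initial {g : ℕ → Plane} (hg : Function.Injective g)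
    (hs : StrictMono fun n => ‖g n‖) {r : ℝ} {n : ℕ} :
    (Set.range g ∩ Metric.closedBall 0 r).encard = n ↔ ∀ m, ‖g m‖ ≤ r ↔ m < n := by
  rw [encard_range_inter hg]
  simp only [mem_closedBall_zero_iff]
  constructor
  · intro hcard m
    have hfin : {m | ‖g m‖ ≤ r}.Finite := Set.finite_of_encard_eq_coe hcard
    constructor
    · intro hm
      have hsub : (Finset.range (m + 1) : Set ℕ) ⊆ {m | ‖g m‖ ≤ r} := fun i hi =>
        (hs.monotone (Nat.lt_succ_iff.1 (Finset.mem_range.1 (Finset.mem_coe.1 hi)))).trans hm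
      have := Set.encard_le_encard hsub
      rw [hcard, Set.encard_coe_eq_coe_finsetCard, Finset.card_range] at this
      exact_mod_cast this
    · intro hm
      by_contra hgt
      have hsub : {m | ‖g m‖ ≤ r} ⊆ (Finset.range m : Set ℕ) := fun i hi => by
        rw [Finset.mem_coe, Finset.mem_range]
        by_contra hi'
        exact hgt ((hs.monotone (not_lt.1 hi')).trans hi)
      have := Set.encard_le_encard hsub
      rw [hcard, Set.encard_coe_eq_coe_finsetCard, Finset.card_range] at this
      have : n ≤ m := by exact_mod_cast this
      omega
  · intro hm
    have : {m | ‖g m‖ ≤ r} = (Finset.range n : Set ℕ) := by ext m; simp [hm]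
    rw [this, Set.encard_coe_eq_coe_finsetCard, Finset.card_range]

/-- The configurations of counts for which the `n`-th nearest point belongs to `A`. -/
def nthMem (n : ℕ) {A : Set Plane} (hA : MeasurableSet A) :
    Set (IsHomogeneousPPP.FiniteAreaSet → ℕ∞) :=
  {c | ∃ r s : ℚ, c (disc r) = n ∧ c (disc s) = (n + 1 : ℕ) ∧ c (ringPart r s hA) = 1}

theorem measurableSet_nthMem (n : ℕ) {A : Set Plane} (hA : MeasurableSet A) :
    MeasurableSet (nthMem n hA) := by
  simp only [nthMem, Set.ofPred_exists]
  refine MeasurableSet.iUnion fun r => MeasurableSet.iUnion fun s => ?_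
  exact (measurableSet_eq_fun (by fun_prop) (by fun_prop)).inter
    ((measurableSet_eq_fun (by fun_prop) (by fun_prop)).inter
      (measurableSet_eq_fun (by fun_prop) (by fun_prop)))

/-- Discs holding `n` and `n + 1` points differ by a ring whose only point is `g n`, so its location
is read off from counts. Strict ordering leaves room for rational radii, which keeps the event a
countable union. -/
theorem counts_mem_nthMem_iff {Ω : Type*} {Φ : Ω → Set Plane} {ω : Ω} {g : ℕ → Plane}
    (hΦ : Φ ω = Set.range g) (h0 : 0 < ‖g 0‖)
    (hs : StrictMono fun n => ‖g n‖) (n : ℕ) {A : Set Plane} (hA : MeasurableSet A) :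
    IsHomogeneousPPP.counts Φ ω ∈ nthMem n hA ↔ g n ∈ A := by
  have hg : Function.Injective g := fun m n hmn => hs.injective (congrArg norm hmn)
  have hring : ∀ r s : ℚ, (∀ m, ‖g m‖ ≤ r ↔ m < n) → (∀ m, ‖g m‖ ≤ s ↔ m < n + 1) →
      {m | g m ∈ (Metric.closedBall 0 (s : ℝ) \ Metric.closedBall 0 (r : ℝ)) ∩ A} =
        {m | m = n ∧ g n ∈ A} := by
    intro r s hr hs
    ext m
    simp only [Set.mem_ofPred_eq, Set.mem_inter_iff, Set.mem_sdiff, mem_closedBall_zero_iff, hr, hs]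
    constructor
    · rintro ⟨⟨h1, h2⟩, h3⟩
      obtain rfl : m = n := by omega
      exact ⟨rfl, h3⟩
    · rintro ⟨rfl, h3⟩
      exact ⟨⟨by omega, by omega⟩, h3⟩
  simp only [nthMem, Set.mem_ofPred_eq, IsHomogeneousPPP.counts, disc, ringPart, hΦ,
    encard_initial hg hs]
  constructor
  · rintro ⟨r, s, hr, hs', hc⟩
    rw [encard_range_inter hg, hring r s hr hs'] at hc
    by_contra hn
    simp [hn] at hc
  · intro hn
    obtain ⟨r, hr⟩ : ∃ r : ℚ, ∀ m, ‖g m‖ ≤ r ↔ m < n := by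
      rcases n with _ | n
      -- For the nearest point the inner disc must be empty, hence a radius below `‖g 0‖`.
      · obtain ⟨r, -, hr⟩ := exists_rat_btwn h0
        refine ⟨r, fun m => ⟨fun hm => ?_, fun hm => by omega⟩⟩
        have : ‖g 0‖ ≤ ‖g m‖ := hs.monotone (Nat.zero_le m)
        linarith
      · obtain ⟨r, hr1, hr2⟩ := exists_rat_btwn (hs (Nat.lt_succ_self n))
        refine ⟨r, fun m => ⟨fun hm => hs.lt_iff_lt.1 (hm.trans_lt hr2), fun hm => ?_⟩⟩
        exact (hs.monotone (Nat.lt_succ_iff.1 hm)).trans hr1.le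
    obtain ⟨s, hs1, hs2⟩ := exists_rat_btwn (hs (Nat.lt_succ_self n))
    have hs' : ∀ m, ‖g m‖ ≤ s ↔ m < n + 1 := fun m =>
      ⟨fun hm => hs.lt_iff_lt.1 (hm.trans_lt hs2), fun hm =>
        (hs.monotone (Nat.lt_succ_iff.1 hm)).trans hs1.le⟩
    refine ⟨r, s, hr, hs', ?_⟩
    rw [encard_range_inter hg, hring r s hr hs']
    simp [hn]

theorem measurable_stations (h : IsUplinkNetwork P Y U lam) : Measurable fun ω n => Y n ω :=
  measurable_pi_lambda _ h.measurable_station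

theorem measurable_mobiles (h : IsUplinkNetwork P Y U lam) : Measurable fun ω n => U n ω :=
  measurable_pi_lambda _ h.measurable_mobile

/-- The law of the base stations depends on their density only. -/
theorem map_stations_eq {Ω' : Type u} [MeasurableSpace Ω'] {P' : Measure Ω'}
    {Y' U' : ℕ → Ω' → Plane} (hlam : 0 < lam)
    (h : IsUplinkNetwork P Y U lam) (h' : IsUplinkNetwork P' Y' U' lam) :
    P.map (fun ω n => Y n ω) = P'.map fun ω n => Y' n ω := by
  have := h.isProbabilityMeasure
  have := h'.isProbabilityMeasure
  have := Measure.isProbabilityMeasure_map (μ := P) h.measurable_stations.aemeasurable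
  refine measure_pi_ext fun s A hA => ?_
  let E : ℕ → Set (IsHomogeneousPPP.FiniteAreaSet → ℕ∞) := fun
    | 0 => {_c | (0 : Plane) ∈ A 0}
    | n + 1 => nthMem n (hA (n + 1))
  have hE : MeasurableSet (⋂ n ∈ s, E n) := by
    refine Finset.measurableSet_biInter s fun n _ => ?_
    rcases n with _ | n
    · exact MeasurableSet.const _
    · exact measurableSet_nthMem n _
  have key : ∀ {Ω₁ : Type u} [MeasurableSpace Ω₁] {P₁ : Measure Ω₁} {Y₁ U₁ : ℕ → Ω₁ → Plane}
      (_ : IsUplinkNetwork P₁ Y₁ U₁ lam), (P₁.map fun ω n => Y₁ n ω) {f | ∀ i ∈ s, f i ∈ A i} =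
        (P₁.map (IsHomogeneousPPP.counts fun ω => Set.range fun n => Y₁ (n + 1) ω))
          (⋂ n ∈ s, E n) := by
    intro Ω₁ _ P₁ Y₁ U₁ h₁
    rw [Measure.map_apply h₁.poisson.measurable_counts hE,
      Measure.map_apply h₁.measurable_stations]
    · refine measure_congr (Filter.eventuallyEq_set.2 ?_)
      filter_upwards [h₁.ae_strictMono hlam] with ω hω
      simp only [Set.preimage_ofPred_eq, Set.mem_ofPred_eq, Set.mem_preimage, Set.mem_iInter]
      refine forall₂_congr fun n _ => ?_
      rcases n with _ | n
      · simp only [h₁.typical ω]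
        rfl
      · refine (counts_mem_nthMem_iff (g := fun n => Y₁ (n + 1) ω) rfl ?_ ?_ n _).symm
        · have := hω (zero_lt_one (α := ℕ))
          simpa [h₁.typical ω] using this
        · exact fun m n hmn => hω (Nat.succ_lt_succ hmn)
    · exact MeasurableSet.pi s.countable_toSet (t := A) fun i _ => hA i
  rw [key h, key h', h.poisson.map_counts_eq h'.poisson]

end IsUplinkNetwork

/-! ### Uniform laws on Voronoi cells -/

noncomputable section

/-- The Voronoi cell of the `i`-th station of a sequence of stations. -/
abbrev stationCell (i : ℕ) (y : ℕ → Plane) : Set Plane := voronoiCell (Set.range y) (y i)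

theorem mem_stationCell {i : ℕ} {y : ℕ → Plane} {x : Plane} :
    x ∈ stationCell i y ↔ ∀ n, dist x (y i) ≤ dist x (y n) := by
  simp [voronoiCell]

theorem measurableSet_stationCell_graph (i : ℕ) :
    MeasurableSet {q : (ℕ → Plane) × Plane | q.2 ∈ stationCell i q.1} := by
  simp only [mem_stationCell, Set.ofPred_forall]
  exact MeasurableSet.iInter fun n => measurableSet_le (by fun_prop) (by fun_prop)

theorem measurableSet_stationCell (i : ℕ) (y : ℕ → Plane) : MeasurableSet (stationCell i y) :=
  measurable_prodMk_left (x := y) (measurableSet_stationCell_graph i)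

/-- The uniform distribution on the Voronoi cell of the `i`-th station, as a kernel. -/
def cellKernel (i : ℕ) : Kernel (ℕ → Plane) Plane where
  toFun y := cond volume (stationCell i y)
  measurable' := by
    refine Measure.measurable_of_measurable_coe _ fun A hA => ?_
    simp only [cond_apply (measurableSet_stationCell i _)]
    refine Measurable.mul (Measurable.inv ?_) ?_
    · exact measurable_measure_prodMk_left (ν := volume) (measurableSet_stationCell_graph i)
    · exact measurable_measure_prodMk_left (ν := volume)
        ((measurableSet_stationCell_graph i).inter (measurable_snd hA))

theorem cellKernel_apply (i : ℕ) (y : ℕ → Plane) :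
    cellKernel i y = cond volume (stationCell i y) := rfl

instance (i : ℕ) : IsFiniteKernel (cellKernel i) :=
  ⟨1, ENNReal.one_lt_top, fun y => by rw [cellKernel_apply]; exact prob_le_one⟩

theorem stationCell_smul {c : ℝ} (hc : 0 < c) (i : ℕ) (y : ℕ → Plane) :
    (fun x : Plane => c • x) ⁻¹' stationCell i (fun n => c • y n) = stationCell i y := by
  ext x
  rw [Set.mem_preimage, mem_stationCell, mem_stationCell]
  simp only [dist_smul₀]
  refine forall_congr' fun n => mul_le_mul_iff_right₀ (by simpa using hc.ne')

/-- Dilation maps cells to cells, and its Jacobian cancels between the area and the normalization.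
-/
theorem cellKernel_smul {c : ℝ} (hc : 0 < c) (i : ℕ) (y : ℕ → Plane) (A : Set Plane) :
    cellKernel i (fun n => c • y n) A = cellKernel i y ((fun x : Plane => c • x) ⁻¹' A) := by
  have hk : |(c ^ Module.finrank ℝ Plane)⁻¹| ≠ 0 := by positivity
  rw [cellKernel_apply, cellKernel_apply, cond_apply (measurableSet_stationCell i _),
    cond_apply (measurableSet_stationCell i _), ← stationCell_smul hc i y, ← Set.preimage_inter,
    Measure.addHaar_preimage_smul _ hc.ne', Measure.addHaar_preimage_smul _ hc.ne',
    ENNReal.mul_inv (Or.inl (by simpa using hk)) (Or.inl ENNReal.ofReal_ne_top), mul_mul_mul_comm,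
    ENNReal.inv_mul_cancel (by simpa using hk) ENNReal.ofReal_ne_top, one_mul]

/-! ### Law of the mobiles and conditioning on the environment -/

namespace IsUplinkNetwork

universe u

variable {Ω : Type u} [MeasurableSpace Ω] {P : Measure Ω} {Y U : ℕ → Ω → Plane} {lam : ℝ}

theorem measure_stations_mobiles (h : IsUplinkNetwork P Y U lam) {B : Set (ℕ → Plane)}
    (hB : MeasurableSet B) (s : Finset ℕ) {A : ℕ → Set Plane} (hA : ∀ i, MeasurableSet (A i)) :
    P {ω | (fun n => Y n ω) ∈ B ∧ ∀ i ∈ s, U i ω ∈ A i} =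
      ∫⁻ ω in (fun ω n => Y n ω) ⁻¹' B, ∏ i ∈ s, cellKernel i (fun n => Y n ω) (A i) ∂P :=
  h.uniform B hB s A hA

theorem measurable_prod_cellKernel (s : Finset ℕ) {A : ℕ → Set Plane}
    (hA : ∀ i, MeasurableSet (A i)) :
    Measurable fun y : ℕ → Plane => ∏ i ∈ s, cellKernel i y (A i) :=
  Finset.measurable_fun_prod s fun i _ => (cellKernel i).measurable_coe (hA i)

/-- The law of the mobiles depends on the density of base stations only. -/
theorem map_mobiles_eq {Ω' : Type u} [MeasurableSpace Ω'] {P' : Measure Ω'}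
    {Y' U' : ℕ → Ω' → Plane} (hlam : 0 < lam)
    (h : IsUplinkNetwork P Y U lam) (h' : IsUplinkNetwork P' Y' U' lam) :
    P.map (fun ω n => U n ω) = P'.map fun ω n => U' n ω := by
  have := h.isProbabilityMeasure
  have := Measure.isProbabilityMeasure_map (μ := P) h.measurable_mobiles.aemeasurable
  refine measure_pi_ext fun s A hA => ?_
  have key : ∀ {Ω₁ : Type u} [MeasurableSpace Ω₁] {P₁ : Measure Ω₁} {Y₁ U₁ : ℕ → Ω₁ → Plane}
      (_ : IsUplinkNetwork P₁ Y₁ U₁ lam), (P₁.map fun ω n => U₁ n ω) {f | ∀ i ∈ s, f i ∈ A i} =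
        ∫⁻ y, ∏ i ∈ s, cellKernel i y (A i) ∂(P₁.map fun ω n => Y₁ n ω) := by
    intro Ω₁ _ P₁ Y₁ U₁ h₁
    have hm : MeasurableSet {f : ℕ → Plane | ∀ i ∈ s, f i ∈ A i} :=
      MeasurableSet.pi s.countable_toSet (t := A) fun i _ => hA i
    rw [lintegral_map (measurable_prod_cellKernel s hA) h₁.measurable_stations,
      Measure.map_apply h₁.measurable_mobiles hm]
    have := h₁.measure_stations_mobiles MeasurableSet.univ s hA
    simpa using this
  rw [key h, key h', map_stations_eq hlam h h']

theorem smul (h : IsUplinkNetwork P Y U lam) {c : ℝ} (hc : 0 < c) :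
    IsUplinkNetwork P (fun n ω => c • Y n ω) (fun n ω => c • U n ω) (lam / c ^ 2) where
  isProbabilityMeasure := h.isProbabilityMeasure
  measurable_station n := (h.measurable_station n).const_smul c
  measurable_mobile n := (h.measurable_mobile n).const_smul c
  typical ω := by rw [h.typical ω, smul_zero]
  injective := by
    filter_upwards [h.injective] with ω hω
    exact (smul_right_injective Plane hc.ne').comp hω
  ordered := by
    filter_upwards [h.ordered] with ω hω m n hmn
    simp only [norm_smul]
    exact mul_le_mul_of_nonneg_left (hω hmn) (norm_nonneg c)
  poisson := by
    have hm : Measurable fun x : Plane => c • x := measurable_const_smul c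
    have hvol : ∀ A : Set Plane, volume ((fun x : Plane => c • x) ⁻¹' A) =
        ENNReal.ofReal (1 / c ^ 2) * volume A := fun A => by
      rw [Measure.addHaar_preimage_smul _ hc.ne', finrank_euclideanSpace, Fintype.card_fin,
        abs_of_pos (by positivity), one_div]
    have hcount : ∀ (A : Set Plane) ω, ((Set.range fun n => c • Y (n + 1) ω) ∩ A).encard =
        ((Set.range fun n => Y (n + 1) ω) ∩ (fun x : Plane => c • x) ⁻¹' A).encard := by
      intro A ω
      rw [← (smul_right_injective Plane hc.ne').encard_image
        ((Set.range fun n => Y (n + 1) ω) ∩ _), Set.image_inter_preimage,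
        ← Set.range_comp]
      rfl
    have hfin : ∀ A : Set Plane, volume A ≠ ∞ → volume ((fun x : Plane => c • x) ⁻¹' A) ≠ ∞ :=
      fun A hA => by
        rw [hvol]
        exact ENNReal.mul_ne_top ENNReal.ofReal_ne_top hA
    refine ⟨fun A hA => ?_, fun A hA hv => ?_, fun m A hA hv hd => ?_⟩
    · simp only [hcount]
      exact h.poisson.measurable_count _ (hm hA)
    · simp only [hcount]
      rw [h.poisson.law_count _ (hm hA) (hfin A hv), measureReal_def, hvol, ENNReal.toReal_mul,
        ENNReal.toReal_ofReal (by positivity), ← measureReal_def, ← mul_assoc, mul_one_div]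
    · simp only [hcount]
      exact h.poisson.indep_count m _ (fun i => hm (hA i)) (fun i => hfin _ (hv i))
        fun i j hij => (hd hij).preimage _
  uniform := by
    intro B hB s A hA
    have hm : Measurable fun (y : ℕ → Plane) n => c • y n := by fun_prop
    have hm' : Measurable fun x : Plane => c • x := measurable_const_smul c
    refine (h.measure_stations_mobiles (hm hB) s
      (A := fun i => (fun x : Plane => c • x) ⁻¹' A i) fun i => hm' (hA i)).trans ?_
    refine setLIntegral_congr_fun (h.measurable_stations (hm hB)) fun ω _ => ?_
    exact Finset.prod_congr rfl fun i _ => (cellKernel_smul hc i _ _).symm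

theorem setLIntegral_mobiles (h : IsUplinkNetwork P Y U lam) {g : (ℕ → Plane) → ℝ≥0∞}
    (hg : Measurable g) (s : Finset ℕ) {A : ℕ → Set Plane} (hA : ∀ i, MeasurableSet (A i)) :
    ∫⁻ ω in {ω | ∀ i ∈ s, U i ω ∈ A i}, g (fun n => Y n ω) ∂P =
      ∫⁻ ω, (∏ i ∈ s, cellKernel i (fun n => Y n ω) (A i)) * g (fun n => Y n ω) ∂P := by
  have hF := measurable_prod_cellKernel s hA
  have hY := h.measurable_stations
  have hmap : (P.restrict {ω | ∀ i ∈ s, U i ω ∈ A i}).map (fun ω n => Y n ω) =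
      (P.map fun ω n => Y n ω).withDensity fun y => ∏ i ∈ s, cellKernel i y (A i) := by
    ext B hB
    rw [Measure.map_apply hY hB, Measure.restrict_apply (hY hB), withDensity_apply _ hB,
      setLIntegral_map hB hF hY]
    exact h.measure_stations_mobiles hB s hA
  rw [← lintegral_map hg hY, hmap, lintegral_withDensity_eq_lintegral_mul _ hF hg,
    lintegral_map (hF.mul hg) hY]
  rfl

/-- Given the base stations, a mobile is uniformly distributed in the cell of its station. -/
theorem map_station_mobile (h : IsUplinkNetwork P Y U lam) (i : ℕ) :
    P.map (fun ω => ((fun n => Y n ω), U i ω)) = (P.map fun ω n => Y n ω) ⊗ₘ cellKernel i := by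
  have := h.isProbabilityMeasure
  have hm : Measurable fun ω => ((fun n => Y n ω), U i ω) :=
    h.measurable_stations.prodMk (h.measurable_mobile i)
  refine Measure.ext_prod fun {B A} hB hA => ?_
  rw [Measure.map_apply hm (hB.prod hA), Measure.compProd_apply_prod hB hA,
    setLIntegral_map hB ((cellKernel i).measurable_coe hA) h.measurable_stations]
  have := h.measure_stations_mobiles hB {i} (A := fun _ => A) fun _ => hA
  simp only [Finset.prod_singleton, Finset.mem_singleton, forall_eq] at this
  exact this

theorem ae_mem_cell (h : IsUplinkNetwork P Y U lam) :
    ∀ᵐ ω ∂P, ∀ i, U i ω ∈ stationCell i fun n => Y n ω := by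
  have := h.isProbabilityMeasure
  rw [ae_all_iff]
  intro i
  have hm : Measurable fun ω => ((fun n => Y n ω), U i ω) :=
    h.measurable_stations.prodMk (h.measurable_mobile i)
  have hG := measurableSet_stationCell_graph i
  have h0 : P.map (fun ω => ((fun n => Y n ω), U i ω)) {q | q.2 ∈ stationCell i q.1}ᶜ = 0 := by
    rw [h.map_station_mobile, Measure.compProd_apply hG.compl, lintegral_eq_zero_iff
      (Kernel.measurable_kernel_prodMk_left hG.compl)]
    exact Filter.Eventually.of_forall fun y => by
      have := ae_cond_mem (μ := (volume : Measure Plane)) (measurableSet_stationCell i y)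
      exact this
  rw [Measure.map_apply hm hG.compl] at h0
  exact h0

theorem ae_mobile_ne_zero (h : IsUplinkNetwork P Y U lam) : ∀ᵐ ω ∂P, U 0 ω ≠ 0 := by
  have h0 := h.measure_stations_mobiles MeasurableSet.univ {0} (A := fun _ => {0})
    fun _ => measurableSet_singleton 0
  have hz : ∀ y, cellKernel 0 y {(0 : Plane)} = 0 := fun y =>
    cond_absolutelyContinuous (measure_singleton 0)
  simp only [Finset.prod_singleton, hz, lintegral_zero, Set.mem_univ, true_and,
    Finset.mem_singleton, forall_eq] at h0
  rw [ae_iff]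
  simpa using h0

/-- `cond` on a set of infinite measure is the zero measure, while `uniform` for the whole plane
forces total mass 1 almost surely. -/
theorem ae_volume_cell_ne_top (h : IsUplinkNetwork P Y U lam) :
    ∀ᵐ ω ∂P, volume (stationCell 0 fun n => Y n ω) ≠ ∞ := by
  have := h.isProbabilityMeasure
  have h1 := h.measure_stations_mobiles MeasurableSet.univ {0} (A := fun _ => Set.univ)
    fun _ => MeasurableSet.univ
  simp only [Finset.prod_singleton, Set.mem_univ, implies_true, and_self, Set.ofPred_true,
    Set.preimage_univ, measure_univ, Measure.restrict_univ] at h1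
  have hle : ∀ ω, cellKernel 0 (fun n => Y n ω) Set.univ ≤ 1 := fun ω => by
    rw [cellKernel_apply]; exact prob_le_one
  have hm : Measurable fun ω => cellKernel 0 (fun n => Y n ω) Set.univ :=
    ((cellKernel 0).measurable_coe MeasurableSet.univ).comp h.measurable_stations
  have hae := ae_eq_of_ae_le_of_lintegral_le (μ := P) (Filter.Eventually.of_forall hle)
    (by rw [← h1]; exact ENNReal.one_ne_top) aemeasurable_const (by simp [← h1])
  filter_upwards [hae] with ω hω hv
  rw [cellKernel_apply, cond_eq_zero.2 (Or.inl hv)] at hω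
  simp at hω

/-- Everything but the mobile of the typical station. -/
def environment (Y U : ℕ → Ω → Plane) (ω : Ω) : (ℕ → Plane) × (ℕ → Plane) :=
  (fun n => Y n ω, fun n => U (n + 1) ω)

theorem measurable_environment (h : IsUplinkNetwork P Y U lam) :
    Measurable (environment Y U) :=
  h.measurable_stations.prodMk (measurable_pi_lambda _ fun n => h.measurable_mobile (n + 1))

/-- Given all base stations and all other mobiles, the mobile of the typical station is uniformly
distributed in the typical cell. -/
theorem map_environment_mobile (h : IsUplinkNetwork P Y U lam) :
    P.map (fun ω => (environment Y U ω, U 0 ω)) =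
      P.map (environment Y U) ⊗ₘ (cellKernel 0).comap Prod.fst measurable_fst := by
  have := h.isProbabilityMeasure
  have hE := h.measurable_environment
  have hY := h.measurable_stations
  have hU1 : Measurable fun ω n => U (n + 1) ω :=
    measurable_pi_lambda _ fun n => h.measurable_mobile (n + 1)
  have hm : Measurable fun ω => (environment Y U ω, U 0 ω) := hE.prodMk (h.measurable_mobile 0)
  refine Measure.ext_prod₃' fun {B D A} hB hD hA => ?_
  have hg : Measurable fun y => B.indicator (fun y => cellKernel 0 y A) y :=
    ((cellKernel 0).measurable_coe hA).indicator hB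
  let S : Set Ω := {ω | (fun n => Y n ω) ∈ B ∧ U 0 ω ∈ A}
  have hS : MeasurableSet S := (hY hB).inter (h.measurable_mobile 0 hA)
  -- For fixed `B` and `A`, both sides are finite measures in the other mobiles. Conditional
  -- independence equates them on cylinders, because the factor of the typical mobile splits off the
  -- product.
  have hD' : (P.restrict S).map (fun ω n => U (n + 1) ω) =
      (P.withDensity fun ω => B.indicator (fun y => cellKernel 0 y A) fun n => Y n ω).map
        (fun ω n => U (n + 1) ω) := by
    refine measure_pi_ext fun s D hD => ?_
    have hDm : MeasurableSet {f : ℕ → Plane | ∀ i ∈ s, f i ∈ D i} :=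
      MeasurableSet.pi s.countable_toSet (t := D) fun i _ => hD i
    let t : Finset ℕ := s.map ⟨Nat.succ, Nat.succ_injective⟩
    let A' : ℕ → Set Plane := fun | 0 => A | n + 1 => D n
    have hA' : ∀ i, MeasurableSet (A' i) := fun | 0 => hA | n + 1 => hD n
    have ht : ∀ ω, (∀ i ∈ t, U i ω ∈ A' i) ↔ ∀ i ∈ s, U (i + 1) ω ∈ D i := fun ω => by
      simp [t, A']
    have h0 : 0 ∉ t := by simp [t]
    rw [Measure.map_apply hU1 hDm, Measure.map_apply hU1 hDm, Measure.restrict_apply (hU1 hDm),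
      withDensity_apply _ (hU1 hDm)]
    have h1 := h.measure_stations_mobiles hB (insert 0 t) hA'
    have h2 := h.setLIntegral_mobiles hg t hA'
    simp only [ht] at h2
    refine Eq.trans ?_ (h1.trans (Eq.trans ?_ h2.symm))
    · congr 1
      ext ω
      simp only [Set.mem_inter_iff, Set.mem_preimage, Set.mem_ofPred_eq, Finset.forall_mem_insert,
        ht, S, A']
      tauto
    · rw [← lintegral_indicator (hY hB)]
      refine lintegral_congr fun ω => ?_
      simp only [Finset.prod_insert h0]
      by_cases hω : (fun n => Y n ω) ∈ B
      · rw [Set.indicator_of_mem hω, Set.indicator_of_mem (Set.mem_preimage.2 hω), mul_comm]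
      · rw [Set.indicator_of_notMem hω, Set.indicator_of_notMem (mt Set.mem_preimage.1 hω),
          mul_zero]
  have hfin := congrArg (fun ν : Measure (ℕ → Plane) => ν D) hD'
  rw [Measure.map_apply hU1 hD, Measure.map_apply hU1 hD, Measure.restrict_apply (hU1 hD),
    withDensity_apply _ (hU1 hD)] at hfin
  rw [Measure.map_apply hm ((hB.prod hD).prod hA), Measure.compProd_apply_prod (hB.prod hD) hA,
    setLIntegral_map (hB.prod hD) (Kernel.measurable_coe _ hA) hE]
  refine Eq.trans ?_ (hfin.trans ?_)
  · congr 1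
    ext ω
    simp only [environment, Set.mem_preimage, Set.mem_prod, Set.mem_inter_iff, S,
      Set.mem_ofPred_eq]
    tauto
  · rw [← lintegral_indicator (hU1 hD), ← lintegral_indicator (hE (hB.prod hD))]
    refine lintegral_congr fun ω => ?_
    have hiff : ω ∈ environment Y U ⁻¹' B ×ˢ D ↔
        (fun n => Y n ω) ∈ B ∧ ω ∈ (fun ω n => U (n + 1) ω) ⁻¹' D := Iff.rfl
    simp only [Set.indicator, hiff, Kernel.comap_apply]
    split_ifs <;> first | rfl | tauto

theorem measure_environment_mobile (h : IsUplinkNetwork P Y U lam)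
    {E : Set (((ℕ → Plane) × (ℕ → Plane)) × Plane)} (hE : MeasurableSet E) :
    P {ω | (environment Y U ω, U 0 ω) ∈ E} =
      ∫⁻ ω, cellKernel 0 (fun n => Y n ω) {x | (environment Y U ω, x) ∈ E} ∂P := by
  have := h.isProbabilityMeasure
  have hm : Measurable fun ω => (environment Y U ω, U 0 ω) :=
    h.measurable_environment.prodMk (h.measurable_mobile 0)
  have := congrArg (fun ν : Measure _ => ν E) h.map_environment_mobile
  rw [Measure.map_apply hm hE, Measure.compProd_apply hE,
    lintegral_map (Kernel.measurable_kernel_prodMk_left hE) h.measurable_environment] at this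
  exact this

end IsUplinkNetwork

end

/-! ### Path loss: measurability, scaling, outage inequality -/

noncomputable section

section PathLoss

variable {α : ℝ} {K : ℕ}

/-- Witnessing the count by a finite set of labels makes the event a countable union, and shows that
only mobiles with nonzero label matter. -/
theorem notMem_canceled_iff {u : ℕ → Plane} {n : ℕ} (hn : n ≠ 0) :
    n ∉ canceled K u ↔ ∃ s : Finset ℕ, s.card = K ∧ ∀ m ∈ s, m ≠ 0 ∧ ‖u m‖ < ‖u n‖ := by
  simp only [canceled, Set.mem_ofPred_eq, hn, not_false_eq_true, ne_eq, true_and, not_lt]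
  constructor
  · intro h
    obtain ⟨t, ht, hK⟩ := Set.exists_subset_encard_eq h
    have hfin := Set.finite_of_encard_eq_coe hK
    refine ⟨hfin.toFinset, ?_, fun m hm => ht (hfin.mem_toFinset.1 hm)⟩
    rw [hfin.encard_eq_coe_toFinset_card] at hK
    exact_mod_cast hK
  · rintro ⟨s, rfl, hs⟩
    rw [← Set.encard_coe_eq_coe_finsetCard]
    exact Set.encard_le_encard fun m hm => hs m hm

theorem measurableSet_interferer (K n : ℕ) :
    MeasurableSet {u : ℕ → Plane | n ≠ 0 ∧ n ∉ canceled K u} := by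
  by_cases hn : n = 0
  · simp [hn]
  · simp only [ne_eq, hn, not_false_eq_true, true_and, notMem_canceled_iff hn, Set.ofPred_exists]
    refine MeasurableSet.iUnion fun s => ?_
    by_cases hs : s.card = K
    · simp only [hs, true_and, Set.ofPred_forall]
      refine Finset.measurableSet_biInter s fun m _ => ?_
      have hlt : MeasurableSet {u : ℕ → Plane | ‖u m‖ < ‖u n‖} :=
        measurableSet_lt (by fun_prop) (by fun_prop)
      exact (MeasurableSet.const (m ≠ 0)).inter hlt
    · simp [hs]

theorem measurable_interference (α : ℝ) (K : ℕ) (p : ℝ) : Measurable (interference α K p) := by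
  refine Measurable.tsum fun n => ?_
  exact Measurable.ite (measurableSet_interferer K n) (by fun_prop) measurable_const

theorem interference_congr {p : ℝ} {u v : ℕ → Plane} (h : ∀ n, u (n + 1) = v (n + 1)) :
    interference α K p u = interference α K p v := by
  have h' : ∀ n, n ≠ 0 → u n = v n := fun n hn => by
    obtain ⟨k, rfl⟩ := Nat.exists_eq_succ_of_ne_zero hn
    exact h k
  refine tsum_congr fun n => ?_
  by_cases hn : n = 0
  · simp [hn]
  · have : n ∉ canceled K u ↔ n ∉ canceled K v := by
      rw [notMem_canceled_iff hn, notMem_canceled_iff hn]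
      refine exists_congr fun s => and_congr_right fun _ => forall₂_congr fun m _ =>
        and_congr_right fun hm => ?_
      rw [h' m hm, h' n hn]
    rw [h' n hn]
    split_ifs <;> first | rfl | tauto

theorem interference_eq_mul (p : ℝ) (u : ℕ → Plane) :
    interference α K p u = ENNReal.ofReal p * interference α K 1 u := by
  simp only [interference, ← ENNReal.tsum_mul_left]
  refine tsum_congr fun n => ?_
  split_ifs <;> simp

theorem enorm_smul_rpow {c : ℝ} (hc : 0 < c) (x : Plane) :
    ‖c • x‖ₑ ^ (-α) = ENNReal.ofReal (c ^ (-α)) * ‖x‖ₑ ^ (-α) := by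
  rw [enorm_smul, ENNReal.mul_rpow_of_ne_top enorm_ne_top enorm_ne_top,
    Real.enorm_of_nonneg hc.le, ENNReal.ofReal_rpow_of_pos hc]

theorem canceled_smul {c : ℝ} (hc : 0 < c) (u : ℕ → Plane) :
    canceled K (fun n => c • u n) = canceled K u := by
  simp only [canceled, norm_smul, mul_lt_mul_iff_right₀ (norm_pos_iff.2 hc.ne')]

theorem interference_smul {c : ℝ} (hc : 0 < c) (p : ℝ) (u : ℕ → Plane) :
    interference α K p (fun n => c • u n) =
      ENNReal.ofReal (c ^ (-α)) * interference α K p u := by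
  simp only [interference, enorm_smul_rpow hc, ← ENNReal.tsum_mul_left]
  refine tsum_congr fun n => ?_
  have hiff : n ∉ canceled K (fun n => c • u n) ↔ n ∉ canceled K u := by rw [canceled_smul hc]
  split_ifs <;> first | tauto | ring

theorem sinr_smul {c : ℝ} (hc : 0 < c) (noise : ℝ) {p : ℝ} (u : ℕ → Plane) :
    sinr α K noise (p * c ^ α) (fun n => c • u n) = sinr α K noise p u := by
  have hp : ∀ x : ℝ≥0∞, ENNReal.ofReal (p * c ^ α) * (ENNReal.ofReal (c ^ (-α)) * x) =
      ENNReal.ofReal p * x := fun x => by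
    rw [← mul_assoc, ← ENNReal.ofReal_mul' (by positivity), mul_assoc, ← Real.rpow_add hc,
      add_neg_cancel, Real.rpow_zero, mul_one]
  rw [sinr, sinr, interference_eq_mul, interference_smul hc, interference_eq_mul p,
    enorm_smul_rpow hc, hp, hp]

theorem measurable_sinr (α : ℝ) (K : ℕ) (noise p : ℝ) : Measurable (sinr α K noise p) := by
  refine Measurable.div (by fun_prop) ((measurable_interference α K p).add_const _)

theorem enorm_rpow_eq_ofReal {x : Plane} (hx : x ≠ 0) :
    ‖x‖ₑ ^ (-α) = ENNReal.ofReal (‖x‖ ^ (-α)) := by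
  rw [← ofReal_norm, ENNReal.ofReal_rpow_of_pos (norm_pos_iff.2 hx)]

/-- The hypotheses exclude the default values: a divergent real sum is 0, and for `α > 0` the real
power `0 ^ (-α)` is 0 whereas the extended one is `∞`. -/
theorem normalizedSum_eq {θ : ℝ} {u : ℕ → Plane} (hu : ∀ n, u n ≠ 0)
    (hI : interference α K 1 u ≠ ∞) :
    normalizedSum α K θ u = (interference α K 1 u).toReal - θ⁻¹ * ‖u 0‖ ^ (-α) := by
  classical
  have hterm : ∀ n, (if n ≠ 0 ∧ n ∉ canceled K u then ‖u n‖ ^ (-α) else 0) =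
      (if n ≠ 0 ∧ n ∉ canceled K u then ENNReal.ofReal 1 * ‖u n‖ₑ ^ (-α) else 0).toReal := by
    intro n
    split_ifs
    · rw [ENNReal.ofReal_one, one_mul, enorm_rpow_eq_ofReal (hu n),
        ENNReal.toReal_ofReal (by positivity)]
    · simp
  rw [normalizedSum, Summable.tsum_sub]
  · congr 1
    · rw [interference, ENNReal.tsum_toReal_eq (ENNReal.ne_top_of_tsum_ne_top hI)]
      exact tsum_congr hterm
    · rw [tsum_ite_eq]
  · simp_rw [hterm]
    exact ENNReal.summable_toReal hI
  · exact (hasSum_ite_eq 0 _).summable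

theorem sinr_lt_iff {θ noise q : ℝ} (hθ : 0 < θ) (hnoise : 0 < noise) (hq : 0 < q)
    {u : ℕ → Plane} (hu : u 0 ≠ 0) (hI : interference α K 1 u ≠ ∞) :
    sinr α K noise q u < ENNReal.ofReal θ ↔
      (interference α K 1 u).toReal - θ⁻¹ * ‖u 0‖ ^ (-α) + noise / q > 0 := by
  obtain ⟨s, hs⟩ : ∃ s, s = (interference α K 1 u).toReal := ⟨_, rfl⟩
  have hs0 : 0 ≤ s := hs ▸ ENNReal.toReal_nonneg
  have hIs : interference α K 1 u = ENNReal.ofReal s := by rw [hs, ENNReal.ofReal_toReal hI]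
  rw [sinr, interference_eq_mul, hIs, enorm_rpow_eq_ofReal hu, ENNReal.toReal_ofReal hs0,
    ← ENNReal.ofReal_mul hq.le, ← ENNReal.ofReal_mul hq.le,
    ← ENNReal.ofReal_add (by positivity) hnoise.le, ← ENNReal.ofReal_div_of_pos (by positivity),
    ENNReal.ofReal_lt_ofReal_iff hθ, div_lt_iff₀ (by positivity)]
  have : s - θ⁻¹ * ‖u 0‖ ^ (-α) + noise / q =
      (θ * (q * s + noise) - q * ‖u 0‖ ^ (-α)) / (θ * q) := by
    field_simp
    ring
  rw [this, gt_iff_lt, div_pos_iff_of_pos_right (by positivity), sub_pos]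

end PathLoss

/-! ### Reduction to unit density and regularity of the exceedance probability -/

namespace IsUplinkNetwork

universe u

variable {Ω : Type u} [MeasurableSpace Ω] {P : Measure Ω} {Y U : ℕ → Ω → Plane} {lam α : ℝ}
  {K : ℕ}

/-- The origin is a station, so a mobile is at least as close to its own station as to the origin;
the triangle inequality does the rest. Path losses of mobiles are thus at most `2 ^ α` times those
of their stations. -/
theorem ae_norm_station_le (h : IsUplinkNetwork P Y U lam) :
    ∀ᵐ ω ∂P, ∀ n, ‖Y n ω‖ ≤ 2 * ‖U n ω‖ := by
  filter_upwards [h.ae_mem_cell] with ω hω n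
  have h1 := mem_stationCell.1 (hω n) 0
  simp only [h.typical ω, dist_zero_right] at h1
  have h2 : ‖Y n ω‖ ≤ ‖U n ω‖ + dist (U n ω) (Y n ω) := by
    rw [dist_eq_norm, norm_sub_rev]
    exact norm_le_norm_add_norm_sub' _ _
  linarith

theorem ae_mobiles_ne_zero (h : IsUplinkNetwork P Y U lam) (hlam : 0 < lam) :
    ∀ᵐ ω ∂P, ∀ n, U n ω ≠ 0 := by
  filter_upwards [h.ae_norm_station_le, h.ae_mobile_ne_zero, h.ae_strictMono hlam]
    with ω hle h0 hs n
  rcases n with _ | n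
  · exact h0
  · intro hn
    have h1 := hs (Nat.succ_pos n)
    have h2 := hle (n + 1)
    rw [hn, norm_zero, mul_zero] at h2
    exact absurd (h1.trans_le h2) (not_lt.2 (norm_nonneg _))

theorem ae_interference_ne_top (h : IsUplinkNetwork P Y U lam) (hlam : 0 < lam) (hα : 2 < α)
    (K : ℕ) : ∀ᵐ ω ∂P, interference α K 1 (fun n => U n ω) ≠ ∞ := by
  filter_upwards [h.ae_norm_station_le, h.ae_strictMono hlam, h.ae_tsum_station_lt_top hlam hα]
    with ω hle hs hsum
  have hpt : ∀ n, ‖U (n + 1) ω‖ₑ ^ (-α) ≤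
      ENNReal.ofReal ((2⁻¹ : ℝ) ^ (-α)) * ‖Y (n + 1) ω‖ₑ ^ (-α) := by
    intro n
    have hpos : 0 < ‖Y (n + 1) ω‖ := (norm_nonneg _).trans_lt (hs (Nat.succ_pos n))
    have hU : 0 < ‖U (n + 1) ω‖ := by linarith [hle (n + 1)]
    rw [enorm_rpow_eq_ofReal (norm_pos_iff.1 hpos), enorm_rpow_eq_ofReal (norm_pos_iff.1 hU),
      ← ENNReal.ofReal_mul (by positivity), ← Real.mul_rpow (by positivity) hpos.le]
    refine ENNReal.ofReal_le_ofReal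
      (Real.rpow_le_rpow_of_nonpos (by positivity) ?_ (by linarith))
    linarith [hle (n + 1)]
  refine ne_top_of_le_ne_top (ENNReal.mul_ne_top (ENNReal.ofReal_ne_top
    (r := (2⁻¹ : ℝ) ^ (-α))) hsum.ne) ?_
  rw [interference, tsum_eq_zero_add' ENNReal.summable, ← ENNReal.tsum_mul_left]
  simp only [ne_eq, not_true_eq_false, false_and, if_false, zero_add]
  refine ENNReal.tsum_le_tsum fun n => ?_
  split_ifs
  · simpa using hpt n
  · exact bot_le

/-- The normalized sum, with the interference computed in `ℝ≥0∞`. -/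
def excess (U : ℕ → Ω → Plane) (α : ℝ) (K : ℕ) (θ : ℝ) (ω : Ω) : ℝ :=
  (interference α K 1 fun n => U n ω).toReal - θ⁻¹ * ‖U 0 ω‖ ^ (-α)

theorem measurable_excess (h : IsUplinkNetwork P Y U lam) (α : ℝ) (K : ℕ) (θ : ℝ) :
    Measurable (excess U α K θ) := by
  have h0 := h.measurable_mobile 0
  exact ((measurable_interference α K 1).comp h.measurable_mobiles).ennreal_toReal.sub
    ((h0.norm.pow_const _).const_mul _)

theorem exceedProb_eq (h : IsUplinkNetwork P Y U lam) (hlam : 0 < lam) (hα : 2 < α) (K : ℕ)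
    (θ m : ℝ) : exceedProb P U α K θ m = P.real {ω | -m < excess U α K θ ω} := by
  refine measureReal_congr (Filter.eventuallyEq_set.2 ?_)
  filter_upwards [h.ae_mobiles_ne_zero hlam, h.ae_interference_ne_top hlam hα K] with ω h0 hI
  rw [normalizedSum_eq h0 hI, gt_iff_lt, neg_lt_iff_pos_add, excess]

theorem outageProb_eq_exceedProb (h : IsUplinkNetwork P Y U lam) (hlam : 0 < lam) (hα : 2 < α)
    (K : ℕ) {θ noise q : ℝ} (hθ : 0 < θ) (hnoise : 0 < noise) (hq : 0 < q) :
    outageProb P U α K θ noise q = exceedProb P U α K θ (noise / q) := by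
  refine measureReal_congr (Filter.eventuallyEq_set.2 ?_)
  filter_upwards [h.ae_mobiles_ne_zero hlam, h.ae_interference_ne_top hlam hα K] with ω h0 hI
  rw [normalizedSum_eq h0 hI, sinr_lt_iff hθ hnoise hq (h0 0) hI]

theorem outageProb_zero (h : IsUplinkNetwork P Y U lam) {θ noise : ℝ} (hθ : 0 < θ) :
    outageProb P U α K θ noise 0 = 1 := by
  have := h.isProbabilityMeasure
  simp [outageProb, sinr, hθ]

/-- The outage probability depends on density and power only through `p * lam ^ (α / 2)`. -/
theorem outageProb_eq_of_unit_density {Ω' : Type u} [MeasurableSpace Ω'] {P' : Measure Ω'}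
    {Y' U' : ℕ → Ω' → Plane} (h : IsUplinkNetwork P Y U lam) (hlam : 0 < lam)
    (h' : IsUplinkNetwork P' Y' U' 1) (θ noise p : ℝ) :
    outageProb P U α K θ noise p = outageProb P' U' α K θ noise (p * lam ^ (α / 2)) := by
  have hc : 0 < √lam := Real.sqrt_pos.2 hlam
  have hscale := h.smul hc
  rw [Real.sq_sqrt hlam.le, div_self hlam.ne'] at hscale
  have hmap := map_mobiles_eq one_pos hscale h'
  have hD : MeasurableSet {u | sinr α K noise (p * lam ^ (α / 2)) u < ENNReal.ofReal θ} :=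
    measurableSet_lt (measurable_sinr α K noise _) measurable_const
  have hD' := congrArg (fun ν : Measure (ℕ → Plane) => ν.real {u |
    sinr α K noise (p * lam ^ (α / 2)) u < ENNReal.ofReal θ}) hmap
  simp only [map_measureReal_apply hscale.measurable_mobiles hD,
    map_measureReal_apply h'.measurable_mobiles hD] at hD'
  refine Eq.trans ?_ hD'
  have hpow : lam ^ (α / 2) = √lam ^ α := by
    rw [Real.sqrt_eq_rpow, ← Real.rpow_mul hlam.le]
    congr 1
    ring
  rw [outageProb, hpow]
  simp only [Set.preimage_ofPred_eq, sinr_smul hc]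

/-- The value of `excess` when `x` is the typical mobile and `u` lists the other mobiles. -/
def excessOf (α : ℝ) (K : ℕ) (θ : ℝ) (u : ℕ → Plane) (x : Plane) : ℝ :=
  (interference α K 1 fun n => Nat.casesOn n 0 u).toReal - θ⁻¹ * ‖x‖ ^ (-α)

/-- Interference ignores label 0, so the placeholder 0 that `excessOf` puts there is harmless. -/
theorem excess_eq_excessOf {Ω : Type*} {Y U : ℕ → Ω → Plane} (α : ℝ) (K : ℕ) (θ : ℝ) (ω : Ω) :
    excess U α K θ ω = excessOf α K θ (environment Y U ω).2 (U 0 ω) := by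
  rw [excess, excessOf, interference_congr]
  exact fun n => rfl

theorem measurable_excessOf (α : ℝ) (K : ℕ) (θ : ℝ) :
    Measurable fun q : ((ℕ → Plane) × (ℕ → Plane)) × Plane => excessOf α K θ q.1.2 q.2 := by
  have hm : Measurable fun (q : ((ℕ → Plane) × (ℕ → Plane)) × Plane) (n : ℕ) =>
      (Nat.casesOn n 0 q.1.2 : Plane) := by
    refine measurable_pi_lambda _ fun n => ?_
    rcases n with _ | n
    · exact measurable_const
    · exact (measurable_pi_apply n).comp (measurable_snd.comp measurable_fst)
  have hx : Measurable fun q : ((ℕ → Plane) × (ℕ → Plane)) × Plane => ‖q.2‖ ^ (-α) :=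
    measurable_snd.norm.pow_const _
  exact ((measurable_interference α K 1).comp hm).ennreal_toReal.sub (hx.const_mul _)

theorem measurable_cellKernel_excessOf (α : ℝ) (K : ℕ) (θ : ℝ) {D : Set ℝ}
    (hD : MeasurableSet D) : Measurable fun w : (ℕ → Plane) × (ℕ → Plane) =>
      cellKernel 0 w.1 {x | excessOf α K θ w.2 x ∈ D} := by
  have := Kernel.measurable_kernel_prodMk_left (κ := (cellKernel 0).comap
    (Prod.fst : (ℕ → Plane) × (ℕ → Plane) → (ℕ → Plane)) measurable_fst)
    (measurable_excessOf α K θ hD)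
  exact this

theorem measure_excess_mem (h : IsUplinkNetwork P Y U lam) (α : ℝ) (K : ℕ) (θ : ℝ) {D : Set ℝ}
    (hD : MeasurableSet D) : P {ω | excess U α K θ ω ∈ D} =
      ∫⁻ ω, cellKernel 0 (environment Y U ω).1 {x | excessOf α K θ (environment Y U ω).2 x ∈ D} ∂P := by
  simp only [excess_eq_excessOf (Y := Y)]
  exact h.measure_environment_mobile (measurable_excessOf α K θ hD)

/-- Away from the origin the function is injective in `‖x‖`, so a level set lies in a circle
together with the origin. -/
theorem volume_excessOf_eq {θ : ℝ} (hθ : 0 < θ) (hα : 0 < α) (K : ℕ) (u : ℕ → Plane) (t : ℝ) :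
    volume {x | excessOf α K θ u x ∈ ({t} : Set ℝ)} = 0 := by
  by_cases hx : ∃ x₀ : Plane, x₀ ≠ 0 ∧ excessOf α K θ u x₀ = t
  · obtain ⟨x₀, h0, ht⟩ := hx
    refine measure_mono_null (t := {0} ∪ Metric.sphere 0 ‖x₀‖) ?_
      (measure_union_null (measure_singleton 0) (Measure.addHaar_sphere _ _ _))
    intro x hx
    by_cases hx0 : x = 0
    · exact Or.inl hx0
    · right
      have hx' : excessOf α K θ u x = t := hx
      rw [← ht, excessOf, excessOf, sub_right_inj, mul_right_inj' (inv_pos.2 hθ).ne'] at hx'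
      rw [mem_sphere_zero_iff_norm]
      exact (Real.rpow_left_inj (norm_nonneg x) (norm_nonneg x₀) (by linarith)).1 hx'
  · refine measure_mono_null (t := {0}) ?_ (measure_singleton 0)
    intro x hx'
    by_contra hx0
    exact hx ⟨x, hx0, hx'⟩

theorem measure_excess_eq (h : IsUplinkNetwork P Y U lam) {θ : ℝ} (hθ : 0 < θ) (hα : 0 < α)
    (K : ℕ) (t : ℝ) : P {ω | excess U α K θ ω ∈ ({t} : Set ℝ)} = 0 := by
  rw [h.measure_excess_mem α K θ (measurableSet_singleton t)]
  simp only [cellKernel_apply, cond_absolutelyContinuous (volume_excessOf_eq hθ hα K _ t),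
    lintegral_zero]

theorem exists_annulus {θ : ℝ} (hθ : 0 < θ) (hα : 0 < α) (K : ℕ) (u : ℕ → Plane) {m m' : ℝ}
    (hm : 0 < m) (hmm : m < m') :
    ∃ a b : ℝ, 0 < a ∧ a < b ∧ b ≤ (θ * m) ^ (-α⁻¹) ∧ ∀ x : Plane, a < ‖x‖ → ‖x‖ < b →
      excessOf α K θ u x ∈ Set.Ioc (-m') (-m) := by
  let s : ℝ := (interference α K 1 fun n => Nat.casesOn n 0 u).toReal
  have hs : 0 ≤ s := ENNReal.toReal_nonneg
  have hneg : -α⁻¹ < 0 := by simpa using hα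
  have h1 : 0 < θ * (s + m) := by positivity
  have h2 : θ * (s + m) < θ * (s + m') := by gcongr
  have hinv : ∀ t : ℝ, 0 < t → (t ^ (-α⁻¹)) ^ (-α) = t := fun t ht => by
    rw [← Real.rpow_mul ht.le, neg_mul_neg, inv_mul_cancel₀ hα.ne', Real.rpow_one]
  -- With `s` the interference, the condition reads `θ * (s + m) ≤ ‖x‖ ^ (-α) < θ * (s + m')`. Since
  -- `s ≥ 0`, the outer radius has a bound that does not depend on the other mobiles.
  refine ⟨(θ * (s + m')) ^ (-α⁻¹), (θ * (s + m)) ^ (-α⁻¹), Real.rpow_pos_of_pos (h1.trans h2) _,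
    Real.rpow_lt_rpow_of_neg h1 h2 hneg, Real.rpow_le_rpow_of_nonpos (by positivity)
      (by gcongr; linarith) hneg.le, fun x hxa hxb => ?_⟩
  have hx : 0 < ‖x‖ := (Real.rpow_pos_of_pos (h1.trans h2) _).trans hxa
  have h3 := Real.rpow_lt_rpow_of_neg (Real.rpow_pos_of_pos (h1.trans h2) _) hxa (neg_lt_zero.2 hα)
  have h4 := Real.rpow_lt_rpow_of_neg hx hxb (neg_lt_zero.2 hα)
  rw [hinv _ (h1.trans h2), ← inv_mul_lt_iff₀ hθ] at h3
  rw [hinv _ h1, ← lt_inv_mul_iff₀ hθ] at h4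
  constructor
  · change -m' < s - _
    linarith
  · change s - _ ≤ -m
    linarith

theorem measure_excess_Ioc_pos (h : IsUplinkNetwork P Y U lam) {θ : ℝ} (hθ : 0 < θ) (hα : 0 < α)
    (K : ℕ) {m m' : ℝ} (hm : 0 < m) (hmm : m < m') :
    0 < P {ω | excess U α K θ ω ∈ Set.Ioc (-m') (-m)} := by
  rw [pos_iff_ne_zero]
  intro h0
  have hmeas : Measurable fun ω => cellKernel 0 (environment Y U ω).1
      {x | excessOf α K θ (environment Y U ω).2 x ∈ Set.Ioc (-m') (-m)} :=
    (measurable_cellKernel_excessOf α K θ (D := Set.Ioc (-m') (-m)) measurableSet_Ioc).comp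
      h.measurable_environment
  rw [h.measure_excess_mem α K θ measurableSet_Ioc, lintegral_eq_zero_iff hmeas] at h0
  set R : ℝ := (θ * m) ^ (-α⁻¹)
  -- If the disc of radius `2 * R` contains no other station, the typical cell contains the disc of
  -- radius `R`, hence the annulus.
  have hempty : P {ω | ((Set.range fun n => Y (n + 1) ω) ∩
      Metric.ball (0 : Plane) (2 * R)).encard = 0} ≠ 0 := by
    rw [h.poisson.measure_count_eq_zero measurableSet_ball measure_ball_lt_top.ne]
    simp [Real.exp_pos]
  refine hempty (measure_mono_null ?_ (ae_iff.1 (h0.and h.ae_volume_cell_ne_top)))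
  intro ω hω
  simp only [Set.mem_ofPred_eq, Set.encard_eq_zero, Pi.zero_apply] at hω ⊢
  rintro ⟨hz, hv⟩
  have hfar : ∀ n, 2 * R ≤ ‖Y (n + 1) ω‖ := fun n => by
    by_contra hlt
    have hmem : Y (n + 1) ω ∈ (Set.range fun n => Y (n + 1) ω) ∩ Metric.ball (0 : Plane) (2 * R) :=
      ⟨⟨n, rfl⟩, mem_ball_zero_iff.2 (not_le.1 hlt)⟩
    rw [hω] at hmem
    exact hmem
  obtain ⟨a, b, ha, hab, hb, hx⟩ := exists_annulus hθ hα K (environment Y U ω).2 hm hmm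
  let T : Set Plane := {x | a < ‖x‖ ∧ ‖x‖ < b}
  have hTo : IsOpen T := (isOpen_lt continuous_const continuous_norm).inter
    (isOpen_lt continuous_norm continuous_const)
  have hTn : T.Nonempty := by
    obtain ⟨x, hx⟩ := exists_norm_eq Plane (show 0 ≤ (a + b) / 2 by linarith)
    exact ⟨x, by rw [hx]; linarith, by rw [hx]; linarith⟩
  have hsub : T ⊆ stationCell 0 (fun n => Y n ω) ∩
      {x | excessOf α K θ (environment Y U ω).2 x ∈ Set.Ioc (-m') (-m)} := by
    rintro x ⟨hxa, hxb⟩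
    refine ⟨mem_stationCell.2 fun n => ?_, hx x hxa hxb⟩
    rcases n with _ | n
    · exact le_rfl
    · rw [h.typical ω, dist_zero_right, dist_eq_norm, norm_sub_rev]
      have h1 := hfar n
      have h2 := norm_sub_norm_le (Y (n + 1) ω) x
      linarith
  rw [cellKernel_apply, cond_apply (measurableSet_stationCell 0 _), mul_eq_zero,
    ENNReal.inv_eq_zero] at hz
  rcases hz with hz | hz
  · exact hv hz
  · exact (hTo.measure_pos volume hTn).ne' (measure_mono_null hsub hz)

theorem exceedProb_lt (h : IsUplinkNetwork P Y U lam) (hlam : 0 < lam) (hα : 2 < α) (K : ℕ)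
    {θ : ℝ} (hθ : 0 < θ) {m m' : ℝ} (hm : 0 < m) (hmm : m < m') :
    exceedProb P U α K θ m < exceedProb P U α K θ m' := by
  have := h.isProbabilityMeasure
  rw [h.exceedProb_eq hlam hα, h.exceedProb_eq hlam hα]
  have hX := h.measurable_excess α K θ
  have hunion : {ω | -m' < excess U α K θ ω} = {ω | -m < excess U α K θ ω} ∪
      {ω | excess U α K θ ω ∈ Set.Ioc (-m') (-m)} := by
    ext ω
    simp only [Set.mem_ofPred_eq, Set.mem_union, Set.mem_Ioc]
    constructor
    · intro hω
      exact (lt_or_ge (-m) (excess U α K θ ω)).imp id fun hle => ⟨hω, hle⟩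
    · rintro (hω | hω)
      · linarith
      · exact hω.1
  have hdisj : Disjoint {ω | -m < excess U α K θ ω}
      {ω | excess U α K θ ω ∈ Set.Ioc (-m') (-m)} :=
    Set.disjoint_left.2 fun ω h1 h2 => absurd (show -m < excess U α K θ ω from h1)
      (not_lt.2 (show excess U α K θ ω ∈ Set.Ioc (-m') (-m) from h2).2)
  rw [hunion, measureReal_union hdisj (hX measurableSet_Ioc)]
  have := ENNReal.toReal_pos (h.measure_excess_Ioc_pos (α := α) hθ (by linarith) K hm hmm).ne'
    (measure_ne_top P _)
  rw [← measureReal_def] at this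
  linarith

theorem continuous_exceedProb (h : IsUplinkNetwork P Y U lam) (hlam : 0 < lam) (hα : 2 < α)
    (K : ℕ) {θ : ℝ} (hθ : 0 < θ) :
    Continuous (exceedProb P U α K θ) ∧
      Filter.Tendsto (exceedProb P U α K θ) Filter.atTop (nhds 1) := by
  have := h.isProbabilityMeasure
  have hX := h.measurable_excess α K θ
  have := Measure.isProbabilityMeasure_map (μ := P) hX.aemeasurable
  let ν := P.map (excess U α K θ)
  have heq : exceedProb P U α K θ = fun m => 1 - cdf ν (-m) := by
    funext m
    rw [h.exceedProb_eq hlam hα, cdf_eq_real, ← probReal_compl_eq_one_sub measurableSet_Iic,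
      map_measureReal_apply hX measurableSet_Iic.compl]
    congr 1
    ext ω
    simp
  have hcont : Continuous (cdf ν) := by
    rw [continuous_iff_continuousAt]
    intro t
    -- A jump of the distribution function is the mass of a point, which is zero.
    rw [(monotone_cdf ν).continuousAt_iff_leftLim_eq_rightLim, StieltjesFunction.rightLim_eq]
    have h1 := (cdf ν).measure_singleton t
    rw [measure_cdf, Measure.map_apply hX (measurableSet_singleton t)] at h1
    have h2 := h.measure_excess_eq hθ (by linarith) K t (α := α)
    have h3 : ENNReal.ofReal (cdf ν t - Function.leftLim (cdf ν) t) = 0 := h1.symm.trans h2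
    rw [ENNReal.ofReal_eq_zero] at h3
    exact le_antisymm ((monotone_cdf ν).leftLim_le le_rfl) (by linarith)
  rw [heq]
  refine ⟨by fun_prop, ?_⟩
  have := ((tendsto_cdf_atBot ν).comp Filter.tendsto_neg_atTop_atBot).const_sub 1
  simpa using this

end IsUplinkNetwork

end

/-! ### The feasibility region -/

theorem proposition1 {Ω : ℝ → Type*} [∀ lam, MeasurableSpace (Ω lam)]
    (P : ∀ lam, Measure (Ω lam)) (Y U : ∀ lam, ℕ → Ω lam → Plane)
    (hN : ∀ lam : ℝ, 0 < lam → IsUplinkNetwork (P lam) (Y lam) (U lam) lam)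
    (α : ℝ) (hα : 2 < α) (K : ℕ) (θ : ℝ) (hθ : 0 < θ) (σ : ℝ) (hσ : 0 < σ)
    (ε : ℝ) (hε0 : 0 < ε) (hε1 : ε < 1) :
    (exceedProb (P 1) (U 1) α K θ 0 < ε →
      ∃! μ : ℝ, 0 < μ ∧ exceedProb (P 1) (U 1) α K θ μ = ε) ∧
    ∀ μ : ℝ, 0 < μ → exceedProb (P 1) (U 1) α K θ μ = ε →
      feasibilityRegion (fun lam p => outageProb (P lam) (U lam) α K θ (σ ^ 2) p) ε =
        {x : ℝ × ℝ | 0 ≤ x.1 ∧ 0 ≤ x.2 ∧ x.2 * x.1 ^ (α / 2) ≥ σ ^ 2 / μ} := by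
  have h1 := hN 1 one_pos
  have hmono : StrictMonoOn (exceedProb (P 1) (U 1) α K θ) (Set.Ioi 0) :=
    fun m hm m' _ hmm => h1.exceedProb_lt one_pos hα K hθ hm hmm
  obtain ⟨hcont, hlim⟩ := h1.continuous_exceedProb one_pos hα K hθ
  refine ⟨fun h0 => ?_, fun μ hμ hμε => ?_⟩
  · obtain ⟨M, hM, hM0⟩ := ((hlim.eventually_const_lt hε1).and
      (Filter.eventually_gt_atTop 0)).exists
    obtain ⟨μ, hμ, hμε⟩ := intermediate_value_Ioo hM0.le hcont.continuousOn ⟨h0, hM⟩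
    refine ⟨μ, ⟨hμ.1, hμε⟩, fun μ' hμ' => ?_⟩
    exact hmono.injOn hμ'.1 hμ.1 (hμ'.2.trans hμε.symm)
  · ext ⟨lam, p⟩
    have hσ2 : 0 < σ ^ 2 := by positivity
    simp only [feasibilityRegion, Set.mem_ofPred_eq, ge_iff_le]
    rcases le_or_gt lam 0 with hlam | hlam
    -- Density zero is allowed on the right, but there `0 ^ (α / 2) = 0` violates the bound.
    · refine ⟨fun h => absurd h.1 (not_lt.2 hlam), fun h => ?_⟩
      obtain rfl : lam = 0 := le_antisymm hlam h.1
      have := h.2.2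
      rw [Real.zero_rpow (by linarith), mul_zero] at this
      exact absurd this (not_le.2 (by positivity))
    simp only [hlam, hlam.le, true_and]
    refine and_congr_right fun hp => ?_
    rw [(hN lam hlam).outageProb_eq_of_unit_density hlam h1]
    -- For `q = 0` outage is certain, which exceeds `ε`; otherwise `ε(σ² / q) ≤ ε(μ)` is equivalent
    -- to `σ² / q ≤ μ`.
    rcases (mul_nonneg hp (Real.rpow_nonneg hlam.le (α / 2))).eq_or_lt with hq | hq
    · rw [← hq, h1.outageProb_zero hθ]
      exact iff_of_false (not_le.2 hε1) (not_le.2 (by positivity))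
    · rw [h1.outageProb_eq_exceedProb one_pos hα K hθ hσ2 hq, ← hμε,
        hmono.le_iff_le (Set.mem_Ioi.2 (by positivity)) hμ, div_le_comm₀ hq hμ]
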